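/- Let $d\ge 1$ and let $f$ and $q_0$ be probability densities on $\mathbb{R}^d$ with respect to Lebesgue measure. Let $K:\mathbb{R}^d\to[0,\infty)$, put $K_h(u)=K(u/h)/h^d$ for $h>0$, and let $(\lambda_k)_{k\ge1}$, $(h_k)_{k\ge1}$, $(\eta_k)_{k\ge1}$ be real sequences. The safe and regularized adaptive importance sampling (SRAIS) algorithm generates random vectors $(X_k)_{k\ge1}$ in $\mathbb{R}^d$, defined on one probability space, as follows. With $\mathcal F_k=\sigma(X_1,\dots,X_k)$ and $\mathcal F_0$ trivial, for every $k\ge1$ the conditional law of $X_k$ given $\mathcal F_{k-1}$ has density $q_{k-1}$, where for $n\ge1$ $$q_n=(1-\lambda_n)f_n+\lambda_n q_0,\qquad f_n(x)=\sum_{k=1}^n W_{n,k}^{(\eta_k)}K_{h_n}(x-X_k),$$ $$W_{n,k}^{(\eta_k)}=\frac{W_k^{\eta_k}}{\sum_{j=1}^nW_j^{\eta_j}},\qquad W_k=\frac{f(X_k)}{q_{k-1}(X_k)},$$ with the convention $W_{n,k}^{(\eta_k)}=1/n$ for $1\le k\le n$ if $W_1=\dots=W_n=0$. Assume: 1. (i)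 $\lambda_k\in(0,1]$, $(\lambda_k)_{k\ge1}$ is nonincreasing, $\lambda_k\to0$ and $\log(k)/(k\lambda_k)\to0$; (ii) $h_k>0$, $(h_k)_{k\ge1}$ is nonincreasing, $h_k\to0$ and $\log(k)/(kh_k^d\lambda_k)\to0$; (iii) $\eta_k\in(0,1]$, $\eta_k\to1$, $(1-\eta_k)\log(h_k)\to0$ and $(1-\eta_k)\log(\lambda_{k-1})\to0$ as $k\to\infty$. 2. $f$ is nonnegative, Lipschitz and bounded. 3. $\int K=1$, $\int\|u\|K(u)\,du<\infty$, $\int K^{1/2}<\infty$, $\int\|u\|K(u)^{1/2}\,du<\infty$, and $K$ is bounded and Lipschitz. 4. $q_0$ is bounded, and there are $c>0$ and $\delta>0$ such that $c(1+\|x\|^\delta)f(x)\le q_0(x)$ for all $x\in\mathbb{R}^d$. 5. There are $C_K>0$ and $r_K>0$ such that $K(x)\le C_K(1+\|x\|)^{-r_K}$ for all $x\in\mathbb{R}^d$. Then, almost surely, $$\sup_{x\in\mathbb{R}^d}|f_n(x)-f(x)|\to0\quad\text{as }n\to\infty.$$ -/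

import Mathlib

open MeasureTheory Filter Topology

/-- The Euclidean space `ℝ^d`. -/
abbrev Rd (d : ℕ) : Type := EuclideanSpace ℝ (Fin d)

/-- A probability density function on `ℝ^d` with respect to Lebesgue measure. -/
structure IsDensity {d : ℕ} (g : Rd d → ℝ) : Prop where
  measurable : Measurable g
  nonneg : ∀ x, 0 ≤ g x
  integral_eq_one : ∫ x, g x = 1

/-- The rescaled kernel `K_h(u) = K(u/h)/h^d`. -/
noncomputable def scaledKernel {d : ℕ} (K : Rd d → ℝ) (h : ℝ) (u : Rd d) : ℝ :=
  K (h⁻¹ • u) / h ^ d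

/-- The regularized importance weight `W_k^{η_k} = (f(x_k) / q_{k-1}(x_k))^{η_k}`, `k ≥ 1`,
along a path `x` of particles, for a sequence `q` of proposals. -/
noncomputable def regWeight {d : ℕ} (f : Rd d → ℝ) (η : ℕ → ℝ) (q : ℕ → Rd d → ℝ)
    (x : ℕ → Rd d) (k : ℕ) : ℝ :=
  (f (x k) / q (k - 1) (x k)) ^ (η k)

open Classical in
/-- The normalized regularized weights `W_{n,k}^{(η_k)}`, `1 ≤ k ≤ n`: proportional to
`W_k^{η_k}` with sum `1`. If the weights `W_1^{η_1}, …, W_n^{η_n}` all vanish, hence are all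
equal, the normalized weights are all equal to `1/n`. -/
noncomputable def normWeight {d : ℕ} (f : Rd d → ℝ) (η : ℕ → ℝ) (q : ℕ → Rd d → ℝ)
    (x : ℕ → Rd d) (n k : ℕ) : ℝ :=
  if ∑ j ∈ Finset.Icc 1 n, regWeight f η q x j = 0 then 1 / (n : ℝ)
  else regWeight f η q x k / ∑ j ∈ Finset.Icc 1 n, regWeight f η q x j

/-- The kernel estimate `f_n(y) = ∑_{k=1}^n W_{n,k}^{(η_k)} K_{h_n}(y - x_k)` along a path `x`
of particles, for a sequence `q` of proposals (only `q_0, …, q_{n-1}` are used). -/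
noncomputable def kernelEstimate {d : ℕ} (f K : Rd d → ℝ) (h η : ℕ → ℝ) (q : ℕ → Rd d → ℝ)
    (x : ℕ → Rd d) (n : ℕ) (y : Rd d) : ℝ :=
  ∑ k ∈ Finset.Icc 1 n, normWeight f η q x n k * scaledKernel K (h n) (y - x k)

/-- The proposals of the algorithm along a path `x = (x_1, x_2, …)` of particles:
`q_0` is the safe density, and `q_k = (1 - λ_k) f_k + λ_k q_0` for `k ≥ 1`, where `f_k` is the
kernel estimate computed from `x_1, …, x_k` and `q_0, …, q_{k-1}` (see `proposal_succ`). -/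
noncomputable def proposal {d : ℕ} (f q₀ K : Rd d → ℝ) (lam h η : ℕ → ℝ)
    (x : ℕ → Rd d) : ℕ → Rd d → ℝ
  | 0 => q₀
  | k + 1 => fun y =>
      (1 - lam (k + 1)) *
          kernelEstimate f K h η
            (fun j => if _hj : j < k + 1 then proposal f q₀ K lam h η x j else q₀) x (k + 1) y
        + lam (k + 1) * q₀ y

/-- The kernel estimate `f_n` produced by the algorithm along a path `x` of particles. -/
noncomputable def sraisEstimate {d : ℕ} (f q₀ K : Rd d → ℝ) (lam h η : ℕ → ℝ)
    (x : ℕ → Rd d) (n : ℕ) (y : Rd d) : ℝ :=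
  kernelEstimate f K h η (proposal f q₀ K lam h η x) x n y

theorem kernelEstimate_congr {d : ℕ} (f K : Rd d → ℝ) (h η : ℕ → ℝ) (q q' : ℕ → Rd d → ℝ)
    (x : ℕ → Rd d) (n : ℕ) (y : Rd d) (hq : ∀ j < n, q j = q' j) :
    kernelEstimate f K h η q x n y = kernelEstimate f K h η q' x n y := by
  have hw : ∀ k ∈ Finset.Icc 1 n, regWeight f η q x k = regWeight f η q' x k := by
    intro k hk
    rw [Finset.mem_Icc] at hk
    simp only [regWeight]
    rw [hq (k - 1) (by omega)]
  have hs := Finset.sum_congr rfl hw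
  refine Finset.sum_congr rfl fun k hk => ?_
  simp only [normWeight]
  rw [hs, hw k hk]

theorem proposal_zero {d : ℕ} (f q₀ K : Rd d → ℝ) (lam h η : ℕ → ℝ) (x : ℕ → Rd d) :
    proposal f q₀ K lam h η x 0 = q₀ := by
  rw [proposal]

/-- The recursion `q_{k+1} = (1 - λ_{k+1}) f_{k+1} + λ_{k+1} q_0`. -/
theorem proposal_succ {d : ℕ} (f q₀ K : Rd d → ℝ) (lam h η : ℕ → ℝ) (x : ℕ → Rd d) (k : ℕ)
    (y : Rd d) :
    proposal f q₀ K lam h η x (k + 1) y =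
      (1 - lam (k + 1)) * sraisEstimate f q₀ K lam h η x (k + 1) y + lam (k + 1) * q₀ y := by
  rw [proposal, sraisEstimate]
  dsimp only
  congr 2
  refine kernelEstimate_congr f K h η _ _ x (k + 1) y fun j hj => ?_
  simp [hj]

/-- `ℱ_k = σ(X_1, …, X_k)`; `ℱ_0` is trivial. -/
@[reducible] def history {d : ℕ} {Ω : Type*} (X : ℕ → Ω → Rd d) (k : ℕ) : MeasurableSpace Ω :=
  ⨆ i ∈ Finset.Icc 1 k, MeasurableSpace.comap (X i) inferInstance

/-- The sequence of random variables `(X_k)_{k ≥ 1}` has policy `(q_k)_{k ≥ 0}`: for all `k ≥ 1`,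
conditionally on `ℱ_{k-1}`, the law of `X_k` has density `q_{k-1}`. The value `X 0` is
not used. -/
structure HasPolicy {d : ℕ} {Ω : Type*} [MeasurableSpace Ω] (P : Measure Ω)
    (X : ℕ → Ω → Rd d) (q : ℕ → Ω → Rd d → ℝ) : Prop where
  measurable : ∀ k, 1 ≤ k → Measurable (X k)
  condLaw : ∀ k, 1 ≤ k → ∀ B : Set (Rd d), MeasurableSet B →
    P[(X k ⁻¹' B).indicator (fun _ => (1 : ℝ)) | history X (k - 1)]
      =ᵐ[P] fun ω => ∫ y in B, q (k - 1) ω y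

/-- The particles `(X_k)_{k ≥ 1}` are generated by the safe and regularized adaptive importance
sampling algorithm: their policy is the sequence of proposals computed from their own path. -/
def IsSRAIS {d : ℕ} {Ω : Type*} [MeasurableSpace Ω] (P : Measure Ω) (X : ℕ → Ω → Rd d)
    (f q₀ K : Rd d → ℝ) (lam h η : ℕ → ℝ) : Prop :=
  HasPolicy P X fun k ω => proposal f q₀ K lam h η (fun i => X i ω) k

/-- The conditions on the mixture weights `λ_k`, the bandwidths `h_k` and the learning rates
`η_k`, `k ≥ 1` (the values at `0` are irrelevant). -/
structure SequenceConditions (d : ℕ) (lam h η : ℕ → ℝ) : Prop where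
  lam_mem : ∀ k, 1 ≤ k → 0 < lam k ∧ lam k ≤ 1
  lam_antitone : AntitoneOn lam (Set.Ici 1)
  lam_tendsto : Tendsto lam atTop (𝓝 0)
  lam_rate : Tendsto (fun k : ℕ => Real.log k / (k * lam k)) atTop (𝓝 0)
  h_pos : ∀ k, 1 ≤ k → 0 < h k
  h_antitone : AntitoneOn h (Set.Ici 1)
  h_tendsto : Tendsto h atTop (𝓝 0)
  h_rate : Tendsto (fun k : ℕ => Real.log k / (k * h k ^ d * lam k)) atTop (𝓝 0)
  η_mem : ∀ k, 1 ≤ k → 0 < η k ∧ η k ≤ 1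
  η_tendsto : Tendsto η atTop (𝓝 1)
  η_h : Tendsto (fun k : ℕ => (1 - η k) * Real.log (h k)) atTop (𝓝 0)
  η_lam : Tendsto (fun k : ℕ => (1 - η k) * Real.log (lam (k - 1))) atTop (𝓝 0)

/-- The target `f` is nonnegative, Lipschitz and bounded. -/
structure TargetRegularity {d : ℕ} (f : Rd d → ℝ) : Prop where
  nonneg : ∀ x, 0 ≤ f x
  lipschitz : ∃ L : ℝ, ∀ x y, |f x - f y| ≤ L * ‖x - y‖
  bounded : ∃ U : ℝ, ∀ x, f x ≤ U

/-- The kernel `K ≥ 0` is bounded and Lipschitz with `∫ K = 1`, and `‖u‖ K(u)`, `K(u)^{1/2}`,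
`‖u‖ K(u)^{1/2}` have finite integrals. -/
structure KernelRegularity {d : ℕ} (K : Rd d → ℝ) : Prop where
  nonneg : ∀ u, 0 ≤ K u
  integral_eq_one : ∫ u, K u = 1
  integrable_norm_mul : Integrable fun u => ‖u‖ * K u
  integrable_sqrt : Integrable fun u => √(K u)
  integrable_norm_mul_sqrt : Integrable fun u => ‖u‖ * √(K u)
  bounded : ∃ Kinf : ℝ, ∀ u, K u ≤ Kinf
  lipschitz : ∃ LK : ℝ, 0 < LK ∧ ∀ x u, |K (x + u) - K x| ≤ LK * ‖u‖

/-! ### Structure of the proposals: predictability, measurability, mass, pointwise bounds. -/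

section Proposal

variable {d : ℕ} {f q₀ K : Rd d → ℝ} {lam h η : ℕ → ℝ}

/-! Given the first `k` particles, the mean of `W_{k+1}^η φ(X_{k+1})` is `∫ φ f^η q_k^(1-η)`. The
safe component gives `q_k ≥ c λ_k f`, and boundedness of `K` and `q₀` gives `q_k ≤ B / h_{k+1}^d +
U₀`. Hence `f^η q_k^(1-η)` lies between `lowerFactor * f` and `upperFactor * (f + (1 - η))`. The
conditions coupling `1 - η` with `log λ` and `log h` say that both factors tend to 1. With `φ =
K_{h_n}(x - ·)` the averaged conditional means therefore converge to `f`, uniformly in `x` and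
whatever the past was (`exists_average_bias_le`).

The fluctuations are martingale sums of nonnegative variables bounded by a constant over `h_n^d λ_n`
with bounded conditional means. Their conditional variances are thus at most bound times mean, and
Bernstein's inequality (`measure_abs_centeredSum_ge_le`) gives tails `exp(-κ n h_n^d λ_n)`. By the
rate condition these beat every power of `n`, so Borel–Cantelli controls polynomially many points
`x` simultaneously (`ae_eventually_forall_abs_centeredSum_lt`).

To reach all `x`, a grid of mesh `n^(-4)` fills a ball of radius `n^a`, and the Lipschitz bounds
interpolate. Outside the ball everything is small (`exists_radius`): either the particle is far from
`x` and the kernel is small, or the particle is itself far out and the tail condition on `q₀` makes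
its weight small. The same argument with `φ = 1` shows that the sum of the weights is equivalent to
`n`, and the normalized estimate is the quotient.

Since all bounds hold for every path, the probability is carried out under the law of the path on
the sequence space, where `IsPathPolicy` replaces conditional expectations by an integral identity.
-/

/-- The regularized importance weight of the `(k+1)`-st particle, as a function of the path `s`
(through its first `k` particles) and of the position `y` of the new particle. -/
noncomputable def stepWeight (f q₀ K : Rd d → ℝ) (lam h η : ℕ → ℝ) (k : ℕ) (s : ℕ → Rd d)
    (y : Rd d) : ℝ :=
  (f y / proposal f q₀ K lam h η s k y) ^ η (k + 1)

theorem sum_Icc_one_eq_sum_range (g : ℕ → ℝ) (n : ℕ) :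
    ∑ k ∈ Finset.Icc 1 n, g k = ∑ k ∈ Finset.range n, g (k + 1) := by
  rw [Finset.range_eq_Ico, Finset.sum_Ico_add' g 0 n 1]
  rfl

theorem regWeight_nonneg {q : ℕ → Rd d → ℝ} (hf : ∀ x, 0 ≤ f x) (hq : ∀ k y, 0 ≤ q k y)
    (x : ℕ → Rd d) (k : ℕ) : 0 ≤ regWeight f η q x k :=
  Real.rpow_nonneg (div_nonneg (hf _) (hq _ _)) _

theorem normWeight_nonneg_of_nonneg {q : ℕ → Rd d → ℝ} {x : ℕ → Rd d} {n k : ℕ}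
    (hw : ∀ k ∈ Finset.Icc 1 n, 0 ≤ regWeight f η q x k) (hk : k ∈ Finset.Icc 1 n) :
    0 ≤ normWeight f η q x n k := by
  unfold normWeight
  split_ifs
  · positivity
  · exact div_nonneg (hw k hk) (Finset.sum_nonneg hw)

theorem sum_normWeight {q : ℕ → Rd d → ℝ} {x : ℕ → Rd d} {n : ℕ} (hn : 1 ≤ n) :
    ∑ k ∈ Finset.Icc 1 n, normWeight f η q x n k = 1 := by
  unfold normWeight
  split_ifs with h0
  · have : (n : ℝ) ≠ 0 := by positivity
    simp [this]
  · rw [← Finset.sum_div, div_self h0]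

theorem scaledKernel_nonneg (hK : ∀ u, 0 ≤ K u) {r : ℝ} (hr : 0 ≤ r) (u : Rd d) :
    0 ≤ scaledKernel K r u :=
  div_nonneg (hK _) (pow_nonneg hr d)

theorem proposal_nonneg (hf : ∀ x, 0 ≤ f x) (hq₀ : ∀ x, 0 ≤ q₀ x) (hK : ∀ u, 0 ≤ K u)
    (hlam : ∀ k, 1 ≤ k → 0 < lam k ∧ lam k ≤ 1) (hh : ∀ k, 1 ≤ k → 0 < h k) (s : ℕ → Rd d) :
    ∀ k y, 0 ≤ proposal f q₀ K lam h η s k y := by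
  intro k
  induction k using Nat.strong_induction_on with
  | _ k ih =>
    intro y
    cases k with
    | zero => rw [proposal_zero]; exact hq₀ y
    | succ k =>
      rw [proposal_succ]
      have hl := hlam (k + 1) (by omega)
      refine add_nonneg (mul_nonneg (by linarith [hl.2]) ?_) (mul_nonneg hl.1.le (hq₀ y))
      unfold sraisEstimate kernelEstimate
      refine Finset.sum_nonneg fun j hj => mul_nonneg ?_
        (scaledKernel_nonneg hK (hh (k + 1) (by omega)).le _)
      refine normWeight_nonneg_of_nonneg (fun i hi => ?_) hj
      rw [Finset.mem_Icc] at hi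
      exact Real.rpow_nonneg (div_nonneg (hf _) (ih (i - 1) (by omega) _)) _

/-- The kernel estimate depends only on the first `n` particles and on the proposals which
generated them. -/
theorem kernelEstimate_congr_particles {q q' : ℕ → Rd d → ℝ} {s s' : ℕ → Rd d} {n : ℕ}
    (hq : ∀ j < n, q j = q' j) (hs : ∀ i, 1 ≤ i → i ≤ n → s i = s' i) (y : Rd d) :
    kernelEstimate f K h η q s n y = kernelEstimate f K h η q' s' n y := by
  have hw : ∀ i ∈ Finset.Icc 1 n, regWeight f η q s i = regWeight f η q' s' i := by
    intro i hi
    rw [Finset.mem_Icc] at hi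
    unfold regWeight
    rw [hs i hi.1 hi.2, hq (i - 1) (by omega)]
  have hsum := Finset.sum_congr rfl hw
  refine Finset.sum_congr rfl fun i hi => ?_
  simp only [normWeight]
  rw [hsum, hw i hi, hs i (Finset.mem_Icc.1 hi).1 (Finset.mem_Icc.1 hi).2]

/-- This is the predictability of the proposals. Coordinate 0 of the path is never read, so nothing
is required there. -/
theorem proposal_congr {s s' : ℕ → Rd d} :
    ∀ {k : ℕ}, (∀ i, 1 ≤ i → i ≤ k → s i = s' i) →
      proposal f q₀ K lam h η s k = proposal f q₀ K lam h η s' k := by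
  intro k
  induction k using Nat.strong_induction_on with
  | _ k ih =>
    intro hs
    funext y
    cases k with
    | zero => simp only [proposal_zero]
    | succ k =>
      rw [proposal_succ, proposal_succ]
      unfold sraisEstimate
      rw [kernelEstimate_congr_particles
        (fun j hj => ih j hj fun i hi hi' => hs i hi (by omega)) hs]

theorem sraisEstimate_congr {s s' : ℕ → Rd d} {n : ℕ} (hs : ∀ i, 1 ≤ i → s i = s' i) (y : Rd d) :
    sraisEstimate f q₀ K lam h η s n y = sraisEstimate f q₀ K lam h η s' n y :=
  kernelEstimate_congr_particles (fun _ _ => proposal_congr fun i hi _ => hs i hi)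
    (fun i hi _ => hs i hi) y

/-- Joint measurability in path and point is what Tonelli needs when the new particle is integrated
out. -/
theorem measurable_proposal (hf : Measurable f) (hq₀ : Measurable q₀) (hK : Measurable K) :
    ∀ k, Measurable fun p : (ℕ → Rd d) × Rd d => proposal f q₀ K lam h η p.1 k p.2 := by
  intro k
  induction k using Nat.strong_induction_on with
  | _ k ih =>
    cases k with
    | zero => simp only [proposal_zero]; exact hq₀.comp measurable_snd
    | succ k =>
      simp only [proposal_succ, sraisEstimate, kernelEstimate]
      have hc : ∀ i, Measurable fun p : (ℕ → Rd d) × Rd d => p.1 i :=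
        fun i => (measurable_pi_apply i).comp measurable_fst
      have hw : ∀ i ∈ Finset.Icc 1 (k + 1), Measurable fun p : (ℕ → Rd d) × Rd d =>
          regWeight f η (proposal f q₀ K lam h η p.1) p.1 i := by
        intro i hi
        rw [Finset.mem_Icc] at hi
        unfold regWeight
        refine Measurable.pow_const ((hf.comp (hc i)).div ?_) _
        exact (ih (i - 1) (by omega)).comp (measurable_fst.prodMk (hc i))
      have hsum := Finset.measurable_fun_sum _ hw
      refine Measurable.add (measurable_const.mul ?_) (measurable_const.mul (hq₀.comp measurable_snd))
      refine Finset.measurable_fun_sum _ fun i hi => Measurable.mul ?_ ?_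
      · unfold normWeight
        exact Measurable.ite (hsum (measurableSet_singleton 0)) measurable_const
          ((hw i hi).div hsum)
      · unfold scaledKernel
        exact (hK.comp ((measurable_snd.sub (hc i)).const_smul (h (k + 1))⁻¹)).div_const _

theorem measurable_stepWeight (hf : Measurable f) (hq₀ : Measurable q₀) (hK : Measurable K)
    (k : ℕ) : Measurable fun p : (ℕ → Rd d) × Rd d => stepWeight f q₀ K lam h η k p.1 p.2 :=
  Measurable.pow_const ((hf.comp measurable_snd).div (measurable_proposal hf hq₀ hK k)) _

theorem stepWeight_congr {s s' : ℕ → Rd d} {k : ℕ} (hs : ∀ i, 1 ≤ i → i ≤ k → s i = s' i) :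
    stepWeight f q₀ K lam h η k s = stepWeight f q₀ K lam h η k s' := by
  unfold stepWeight
  rw [proposal_congr hs]

theorem KernelRegularity.continuous (hK : KernelRegularity K) : Continuous K := by
  obtain ⟨L, hL, hLK⟩ := hK.lipschitz
  have : LipschitzWith (Real.toNNReal L) K := by
    refine LipschitzWith.of_dist_le_mul fun x y => ?_
    rw [Real.dist_eq, dist_eq_norm, Real.coe_toNNReal _ hL.le]
    simpa using hLK y (x - y)
  exact this.continuous

theorem KernelRegularity.integrable (hK : KernelRegularity K) : Integrable K := by
  by_contra hc
  have := hK.integral_eq_one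
  rw [integral_undef hc] at this
  exact zero_ne_one this

theorem IsDensity.integrable {g : Rd d → ℝ} (hg : IsDensity g) : Integrable g := by
  by_contra hc
  have := hg.integral_eq_one
  rw [integral_undef hc] at this
  exact zero_ne_one this

theorem integrable_scaledKernel (hK : KernelRegularity K) {r : ℝ} (hr : 0 < r) :
    Integrable (scaledKernel K r) :=
  (hK.integrable.comp_smul (inv_ne_zero hr.ne')).div_const _

theorem integral_scaledKernel (hK : KernelRegularity K) {r : ℝ} (hr : 0 < r) :
    ∫ u, scaledKernel K r u = 1 := by
  unfold scaledKernel
  rw [integral_div, Measure.integral_comp_smul, hK.integral_eq_one]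
  simp [abs_of_pos hr, hr.ne']

theorem integrable_sraisEstimate (hK : KernelRegularity K) {n : ℕ} (hh : 0 < h n)
    (s : ℕ → Rd d) : Integrable (sraisEstimate f q₀ K lam h η s n) := by
  unfold sraisEstimate kernelEstimate
  exact integrable_finsetSum _ fun i _ =>
    ((integrable_scaledKernel hK hh).comp_sub_right (s i)).const_mul _

theorem integral_sraisEstimate (hK : KernelRegularity K) {n : ℕ} (hn : 1 ≤ n) (hh : 0 < h n)
    (s : ℕ → Rd d) : ∫ y, sraisEstimate f q₀ K lam h η s n y = 1 := by
  unfold sraisEstimate kernelEstimate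
  rw [integral_finsetSum _ fun i _ =>
    ((integrable_scaledKernel hK hh).comp_sub_right (s i)).const_mul _]
  simp_rw [integral_const_mul, integral_sub_right_eq_self (scaledKernel K (h n)),
    integral_scaledKernel hK hh, mul_one]
  exact sum_normWeight hn

theorem isDensity_proposal (hf : IsDensity f) (hq₀ : IsDensity q₀) (hK : KernelRegularity K)
    (hlam : ∀ k, 1 ≤ k → 0 < lam k ∧ lam k ≤ 1) (hh : ∀ k, 1 ≤ k → 0 < h k) (s : ℕ → Rd d)
    (k : ℕ) : IsDensity (proposal f q₀ K lam h η s k) := by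
  refine ⟨(measurable_proposal hf.measurable hq₀.measurable hK.continuous.measurable k).comp
    measurable_prodMk_left, proposal_nonneg hf.nonneg hq₀.nonneg hK.nonneg hlam hh s k, ?_⟩
  cases k with
  | zero => rw [proposal_zero]; exact hq₀.integral_eq_one
  | succ k =>
    simp_rw [proposal_succ]
    have hk : 1 ≤ k + 1 := by omega
    rw [integral_add ((integrable_sraisEstimate hK (hh _ hk) s).const_mul _)
      (hq₀.integrable.const_mul _), integral_const_mul, integral_const_mul,
      integral_sraisEstimate hK hk (hh _ hk), hq₀.integral_eq_one]
    ring

theorem sraisEstimate_nonneg (hf : ∀ x, 0 ≤ f x) (hq₀ : ∀ x, 0 ≤ q₀ x) (hK : ∀ u, 0 ≤ K u)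
    (hlam : ∀ k, 1 ≤ k → 0 < lam k ∧ lam k ≤ 1) (hh : ∀ k, 1 ≤ k → 0 < h k) (s : ℕ → Rd d)
    {n : ℕ} (hn : 1 ≤ n) (y : Rd d) : 0 ≤ sraisEstimate f q₀ K lam h η s n y :=
  Finset.sum_nonneg fun _ hj => mul_nonneg
    (normWeight_nonneg_of_nonneg
      (fun i _ => regWeight_nonneg hf (proposal_nonneg hf hq₀ hK hlam hh s) s i) hj)
    (scaledKernel_nonneg hK (hh _ hn).le _)

theorem scaledKernel_le {B r : ℝ} (hB : ∀ u, K u ≤ B) (hr : 0 < r) (u : Rd d) :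
    scaledKernel K r u ≤ B / r ^ d :=
  div_le_div_of_nonneg_right (hB _) (by positivity)

theorem sraisEstimate_le {B : ℝ} (hf : ∀ x, 0 ≤ f x) (hq₀ : ∀ x, 0 ≤ q₀ x) (hK : ∀ u, 0 ≤ K u)
    (hB : ∀ u, K u ≤ B) (hlam : ∀ k, 1 ≤ k → 0 < lam k ∧ lam k ≤ 1) (hh : ∀ k, 1 ≤ k → 0 < h k)
    (s : ℕ → Rd d) {n : ℕ} (hn : 1 ≤ n) (y : Rd d) :
    sraisEstimate f q₀ K lam h η s n y ≤ B / h n ^ d := by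
  calc sraisEstimate f q₀ K lam h η s n y
      ≤ ∑ k ∈ Finset.Icc 1 n,
          normWeight f η (proposal f q₀ K lam h η s) s n k * (B / h n ^ d) :=
        Finset.sum_le_sum fun _ hj => mul_le_mul_of_nonneg_left (scaledKernel_le hB (hh n hn) _)
          (normWeight_nonneg_of_nonneg
            (fun i _ => regWeight_nonneg hf (proposal_nonneg hf hq₀ hK hlam hh s) s i) hj)
    _ = B / h n ^ d := by rw [← Finset.sum_mul, sum_normWeight hn, one_mul]

/-- The mixture weight of the safe density in the `k`-th proposal; it is `1` for `k = 0`. -/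
def safeWeight (lam : ℕ → ℝ) (k : ℕ) : ℝ := if k = 0 then 1 else lam k

theorem safeWeight_mul_le_proposal (hf : ∀ x, 0 ≤ f x) (hq₀ : ∀ x, 0 ≤ q₀ x)
    (hK : ∀ u, 0 ≤ K u) (hlam : ∀ k, 1 ≤ k → 0 < lam k ∧ lam k ≤ 1) (hh : ∀ k, 1 ≤ k → 0 < h k)
    (s : ℕ → Rd d) (k : ℕ) (y : Rd d) :
    safeWeight lam k * q₀ y ≤ proposal f q₀ K lam h η s k y := by
  unfold safeWeight
  cases k with
  | zero => simp [proposal_zero]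
  | succ k =>
    rw [proposal_succ, if_neg (by omega)]
    have := sraisEstimate_nonneg (η := η) hf hq₀ hK hlam hh s (n := k + 1) (by omega) y
    have := mul_nonneg (sub_nonneg.2 (hlam (k + 1) (by omega)).2) this
    linarith

/-- The index `k + 1` in the bandwidth lets one bound cover `k = 0`, where `h 0` is unconstrained;
monotonicity of `h` pays for the shift. -/
theorem proposal_le {B U : ℝ} (hf : ∀ x, 0 ≤ f x) (hq₀ : ∀ x, 0 ≤ q₀ x) (hK : ∀ u, 0 ≤ K u)
    (hB : ∀ u, K u ≤ B) (hU : ∀ x, q₀ x ≤ U)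
    (hlam : ∀ k, 1 ≤ k → 0 < lam k ∧ lam k ≤ 1) (hh : ∀ k, 1 ≤ k → 0 < h k)
    (hanti : AntitoneOn h (Set.Ici 1)) (s : ℕ → Rd d) (k : ℕ) (y : Rd d) :
    proposal f q₀ K lam h η s k y ≤ B / h (k + 1) ^ d + U := by
  have hB0 : 0 ≤ B := (hK 0).trans (hB 0)
  have hh1 := hh (k + 1) (by omega)
  cases k with
  | zero =>
    rw [proposal_zero]
    have : 0 ≤ B / h (0 + 1) ^ d := by positivity
    linarith [hU y]
  | succ k =>
    rw [proposal_succ]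
    have h1 : 1 ≤ k + 1 := by omega
    have hl := hlam (k + 1) h1
    have he := sraisEstimate_nonneg (η := η) hf hq₀ hK hlam hh s h1 y
    have he' := sraisEstimate_le (η := η) hf hq₀ hK hB hlam hh s h1 y
    have hmono : B / h (k + 1) ^ d ≤ B / h (k + 1 + 1) ^ d := by
      have := hanti (Set.mem_Ici.2 h1) (Set.mem_Ici.2 (by omega : 1 ≤ k + 1 + 1)) (by omega)
      gcongr
    have := mul_nonneg hl.1.le he
    have : lam (k + 1) * q₀ y ≤ 1 * q₀ y := mul_le_mul_of_nonneg_right hl.2 (hq₀ y)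
    linarith [hU y]

end Proposal

/-! ### From conditional laws to an integral identity on the path space. -/

section PathLaw

variable {d : ℕ}

/-- The path `s` stopped after its first `k` particles. -/
def truncatePath (k : ℕ) (s : ℕ → Rd d) : ℕ → Rd d := fun i => if i ≤ k then s i else 0

/-- The path `(0, X_1, X_2, …)` of the particles. -/
def particlePath {Ω : Type*} (X : ℕ → Ω → Rd d) (ω : Ω) : ℕ → Rd d :=
  fun i => if i = 0 then 0 else X i ω

theorem measurable_truncatePath (k : ℕ) :
    Measurable (truncatePath k : (ℕ → Rd d) → ℕ → Rd d) := by
  refine measurable_pi_lambda _ fun i => ?_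
  unfold truncatePath
  split_ifs
  · exact measurable_pi_apply i
  · exact measurable_const

/-- Nothing is assumed about `X 0`, not even measurability; overwriting coordinate 0 by a constant
is what makes the path measurable. -/
theorem measurable_particlePath {Ω : Type*} [MeasurableSpace Ω] {X : ℕ → Ω → Rd d}
    (hX : ∀ k, 1 ≤ k → Measurable (X k)) : Measurable (particlePath X) := by
  refine measurable_pi_lambda _ fun i => ?_
  unfold particlePath
  split_ifs with hi
  · exact measurable_const
  · exact hX i (by omega)

/-- A function of the path and of a point is adapted at time `k` if it depends on the path only
through its first `k` particles. -/
def IsAdaptedAt {β : Type*} (k : ℕ) (Y : (ℕ → Rd d) → β) : Prop :=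
  ∀ s s' : ℕ → Rd d, (∀ i, 1 ≤ i → i ≤ k → s i = s' i) → Y s = Y s'

theorem IsAdaptedAt.truncatePath {β : Type*} {k n : ℕ} {Y : (ℕ → Rd d) → β}
    (hY : IsAdaptedAt k Y) (hkn : k ≤ n) (s : ℕ → Rd d) : Y (truncatePath n s) = Y s :=
  hY _ _ fun _ _ hi => if_pos (hi.trans hkn)

/-- Under the law `μ` of the path, the conditional law of the `(k+1)`-st particle given the first
`k` particles has density `q k`. -/
def IsPathPolicy (μ : Measure (ℕ → Rd d)) (q : ℕ → (ℕ → Rd d) → Rd d → ℝ) : Prop :=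
  ∀ (k : ℕ) (g : (ℕ → Rd d) × Rd d → ENNReal), Measurable g →
    ∫⁻ s, g (truncatePath k s, s (k + 1)) ∂μ =
      ∫⁻ s, (∫⁻ y, g (truncatePath k s, y) * ENNReal.ofReal (q k s y)) ∂μ

theorem history_le {Ω : Type*} [mΩ : MeasurableSpace Ω] {X : ℕ → Ω → Rd d}
    (hX : ∀ k, 1 ≤ k → Measurable (X k)) (k : ℕ) : history X k ≤ mΩ :=
  iSup₂_le fun i hi => (hX i (Finset.mem_Icc.1 hi).1).comap_le

/-- Makes events about the first `k` particles admissible in the defining property of conditional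
expectation. -/
theorem measurable_history_truncatePath {Ω : Type*} (X : ℕ → Ω → Rd d) (k : ℕ) :
    Measurable[history X k] fun ω => truncatePath k (particlePath X ω) := by
  refine @measurable_pi_lambda _ _ _ (history X k) _ _ fun i => ?_
  unfold truncatePath particlePath
  by_cases hik : i ≤ k
  · by_cases hi : i = 0
    · simp only [hi, if_true, zero_le]; exact @measurable_const _ _ _ (history X k) _
    · simp only [hik, hi, if_true, if_false]
      have hle : MeasurableSpace.comap (X i) inferInstance ≤ history X k :=
        le_iSup₂_of_le i (Finset.mem_Icc.2 ⟨by omega, hik⟩) le_rfl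
      exact (comap_measurable (X i)).mono hle le_rfl
  · simp only [hik, if_false]; exact @measurable_const _ _ _ (history X k) _

/-- The conditional law determines the joint law of the past and the next particle on rectangles,
hence everywhere; integrating an arbitrary `g` against that joint law gives the identity. -/
theorem HasPolicy.isPathPolicy {Ω : Type*} [MeasurableSpace Ω] {P : Measure Ω}
    [IsProbabilityMeasure P] {X : ℕ → Ω → Rd d} {q : ℕ → (ℕ → Rd d) → Rd d → ℝ}
    (hX : HasPolicy P X fun k ω => q k (particlePath X ω))
    (hq : ∀ k, Measurable fun p : (ℕ → Rd d) × Rd d => q k p.1 p.2)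
    (hq_dens : ∀ k s, IsDensity (q k s)) (hq_adapt : ∀ k, IsAdaptedAt k (q k)) :
    IsPathPolicy (P.map (particlePath X)) q := by
  intro k g hg
  have hpath := measurable_particlePath hX.measurable
  have hXk : Measurable (X (k + 1)) := hX.measurable (k + 1) (by omega)
  set H : Ω → ℕ → Rd d := fun ω => truncatePath k (particlePath X ω) with hH
  have hHm : Measurable H := (measurable_truncatePath k).comp hpath
  have hqH : ∀ ω, q k (H ω) = q k (particlePath X ω) := fun ω =>
    (hq_adapt k).truncatePath le_rfl _
  have hdens : Measurable fun p : (ℕ → Rd d) × Rd d => ENNReal.ofReal (q k p.1 p.2) :=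
    (hq k).ennreal_ofReal
  have key : P.map (fun ω => (H ω, X (k + 1) ω)) =
      ((P.map H).prod volume).withDensity fun p => ENNReal.ofReal (q k p.1 p.2) := by
    have : IsProbabilityMeasure (P.map H) := Measure.isProbabilityMeasure_map hHm.aemeasurable
    have : IsProbabilityMeasure (P.map (fun ω => (H ω, X (k + 1) ω))) :=
      Measure.isProbabilityMeasure_map (hHm.prodMk hXk).aemeasurable
    refine Measure.ext_prod fun {A} {B} hA hB => ?_
    rw [Measure.map_apply (hHm.prodMk hXk) (hA.prod hB), withDensity_apply _ (hA.prod hB),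
      ← Measure.prod_restrict, lintegral_prod _ hdens.aemeasurable,
      setLIntegral_map hA hdens.lintegral_prod_right' hHm]
    have hAm : MeasurableSet[history X k] (H ⁻¹' A) :=
      measurable_history_truncatePath X k hA
    have hle := history_le hX.measurable k
    have hAm' : MeasurableSet (H ⁻¹' A) := hle _ hAm
    have hcond := hX.condLaw (k + 1) (by omega) B hB
    rw [Nat.add_sub_cancel] at hcond
    have hind : Integrable ((X (k + 1) ⁻¹' B).indicator fun _ => (1 : ℝ)) P :=
      (integrable_const _).indicator (hXk hB)
    -- Integrability is inherited from the conditional expectation, to which this function is almost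
    -- surely equal.
    have hint : Integrable (fun ω => ∫ y in B, q k (particlePath X ω) y) P :=
      integrable_condExp.congr hcond
    have h1 := setIntegral_condExp hle hind hAm
    rw [setIntegral_congr_ae hAm' (hcond.mono fun ω hω _ => hω),
      setIntegral_indicator (hXk hB)] at h1
    simp only [integral_const, smul_eq_mul, mul_one, measureReal_restrict_apply_univ] at h1
    have h2 : (fun ω => (H ω, X (k + 1) ω)) ⁻¹' A ×ˢ B = H ⁻¹' A ∩ X (k + 1) ⁻¹' B := rfl
    rw [h2, ← ENNReal.ofReal_toReal (measure_ne_top P _), ← measureReal_def, ← h1,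
      ofReal_integral_eq_lintegral_ofReal hint.integrableOn
        (Eventually.of_forall fun ω => integral_nonneg fun y => (hq_dens k _).nonneg y)]
    refine lintegral_congr fun ω => ?_
    rw [ofReal_integral_eq_lintegral_ofReal (hq_dens k _).integrable.integrableOn
      (Eventually.of_forall fun y => (hq_dens k _).nonneg y)]
    simp only [hqH]
  have hgd := hg.mul hdens
  have h0 : ∫⁻ s, g (truncatePath k s, s (k + 1)) ∂P.map (particlePath X) =
      ∫⁻ ω, g (truncatePath k (particlePath X ω), particlePath X ω (k + 1)) ∂P :=
    lintegral_map (hg.comp ((measurable_truncatePath k).prodMk (measurable_pi_apply (k + 1)))) hpath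
  rw [h0]
  have h3 : ∀ ω, g (truncatePath k (particlePath X ω), particlePath X ω (k + 1)) =
      g (H ω, X (k + 1) ω) := fun ω => by simp [hH, particlePath]
  simp_rw [h3]
  rw [← lintegral_map hg (hHm.prodMk hXk), key, lintegral_withDensity_eq_lintegral_mul _ hdens hg,
    lintegral_prod _ (hdens.mul hg).aemeasurable,
    lintegral_map (hdens.mul hg).lintegral_prod_right' hHm]
  have h4 : ∀ s, ∫⁻ y, g (truncatePath k s, y) * ENNReal.ofReal (q k s y) =
      ∫⁻ y, (g * fun p : (ℕ → Rd d) × Rd d => ENNReal.ofReal (q k p.1 p.2)) (truncatePath k s, y) := fun s => by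
    simp only [Pi.mul_apply, (hq_adapt k).truncatePath le_rfl]
  simp_rw [h4]
  have h5 : ∫⁻ s, (∫⁻ y, (g * fun p : (ℕ → Rd d) × Rd d => ENNReal.ofReal (q k p.1 p.2)) (truncatePath k s, y))
        ∂P.map (particlePath X) =
      ∫⁻ ω, (∫⁻ y, (g * fun p : (ℕ → Rd d) × Rd d => ENNReal.ofReal (q k p.1 p.2)) (H ω, y)) ∂P :=
    lintegral_map (hgd.lintegral_prod_right'.comp (measurable_truncatePath k)) hpath
  rw [h5]
  refine lintegral_congr fun ω => lintegral_congr fun y => ?_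
  simp [hH, mul_comm]

/-! ### Exponential moments and Bernstein's inequality. -/

/-- One step of the exponential supermartingale. -/
theorem lintegral_exp_mul_density_le {q Y : Rd d → ℝ} {b M u : ℝ} (hq : IsDensity q)
    (hY : Measurable Y) (hY0 : ∀ y, 0 ≤ Y y) (hYb : ∀ y, Y y ≤ b) (hM : ∫ y, Y y * q y ≤ M)
    (hu : |u| * b ≤ 1) :
    ∫⁻ y, ENNReal.ofReal (Real.exp (u * (Y y - ∫ z, Y z * q z))) * ENNReal.ofReal (q y) ≤
      ENNReal.ofReal (Real.exp (u ^ 2 * b * M)) := by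
  set m := ∫ z, Y z * q z with hm
  have hb : 0 ≤ b := (hY0 0).trans (hYb 0)
  have hYq : Integrable fun y => Y y * q y :=
    hq.integrable.bdd_mul hY.aestronglyMeasurable
      (Eventually.of_forall fun y => by rw [Real.norm_of_nonneg (hY0 y)]; exact hYb y)
  have hbound : ∀ y, Real.exp (u * (Y y - m)) * q y ≤
      Real.exp (-(u * m)) * (q y + (u + u ^ 2 * b) * (Y y * q y)) := by
    intro y
    have h1 : |u * Y y| ≤ 1 := by
      rw [abs_mul, abs_of_nonneg (hY0 y)]
      exact (mul_le_mul_of_nonneg_left (hYb y) (abs_nonneg u)).trans hu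
    -- `exp x ≤ 1 + x + x²` for `|x| ≤ 1`; then `Y² ≤ b Y` makes the quadratic term linear in `Y`,
    -- so only the mean of `Y` has to be controlled.
    have h2 := (abs_le.1 (Real.abs_exp_sub_one_sub_id_le h1)).2
    have h3 : (u * Y y) ^ 2 ≤ u ^ 2 * b * Y y := by
      have := mul_le_mul_of_nonneg_left (hYb y) (mul_nonneg (sq_nonneg u) (hY0 y))
      nlinarith
    have h4 : Real.exp (u * (Y y - m)) = Real.exp (-(u * m)) * Real.exp (u * Y y) := by
      rw [← Real.exp_add]; ring_nf
    rw [h4, mul_assoc]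
    refine mul_le_mul_of_nonneg_left ?_ (Real.exp_pos _).le
    have := mul_le_mul_of_nonneg_right
      (by linarith : Real.exp (u * Y y) ≤ 1 + u * Y y + u ^ 2 * b * Y y) (hq.nonneg y)
    linarith
  calc ∫⁻ y, ENNReal.ofReal (Real.exp (u * (Y y - m))) * ENNReal.ofReal (q y)
      ≤ ∫⁻ y, ENNReal.ofReal
          (Real.exp (-(u * m)) * (q y + (u + u ^ 2 * b) * (Y y * q y))) := by
        refine lintegral_mono fun y => ?_
        rw [← ENNReal.ofReal_mul (Real.exp_pos _).le]
        exact ENNReal.ofReal_le_ofReal (hbound y)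
    _ = ENNReal.ofReal (∫ y, Real.exp (-(u * m)) * (q y + (u + u ^ 2 * b) * (Y y * q y))) := by
        rw [ofReal_integral_eq_lintegral_ofReal]
        · exact (hq.integrable.add (hYq.const_mul _)).const_mul _
        · exact Eventually.of_forall fun y =>
            (mul_nonneg (Real.exp_pos _).le (hq.nonneg y)).trans (hbound y)
    _ ≤ ENNReal.ofReal (Real.exp (u ^ 2 * b * M)) := by
        refine ENNReal.ofReal_le_ofReal ?_
        rw [integral_const_mul, integral_add hq.integrable (hYq.const_mul _), integral_const_mul,
          hq.integral_eq_one, ← hm]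
        have h5 : 1 + (u + u ^ 2 * b) * m ≤ Real.exp (u * m + u ^ 2 * b * M) := by
          have := Real.add_one_le_exp (u * m + u ^ 2 * b * M)
          have := mul_le_mul_of_nonneg_left hM (mul_nonneg (sq_nonneg u) hb)
          linarith
        calc _ ≤ Real.exp (-(u * m)) * Real.exp (u * m + u ^ 2 * b * M) :=
              mul_le_mul_of_nonneg_left h5 (Real.exp_pos _).le
          _ = _ := by rw [← Real.exp_add]; ring_nf

variable {μ : Measure (ℕ → Rd d)} {q Y : ℕ → (ℕ → Rd d) → Rd d → ℝ} {b M : ℝ}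

/-- The sum of the first `n` values `Y k (X_{k+1})`, centered by their conditional means. -/
noncomputable def centeredSum (q Y : ℕ → (ℕ → Rd d) → Rd d → ℝ) (n : ℕ) (s : ℕ → Rd d) : ℝ :=
  ∑ k ∈ Finset.range n, (Y k s (s (k + 1)) - ∫ y, Y k s y * q k s y)

theorem measurable_condMean {q Y : (ℕ → Rd d) → Rd d → ℝ}
    (hq : Measurable fun p : (ℕ → Rd d) × Rd d => q p.1 p.2)
    (hY : Measurable fun p : (ℕ → Rd d) × Rd d => Y p.1 p.2) :
    Measurable fun s => ∫ y, Y s y * q s y :=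
  ((hY.mul hq).stronglyMeasurable.integral_prod_right' (ν := volume)).measurable

theorem measurable_centeredSum
    (hq : ∀ k, Measurable fun p : (ℕ → Rd d) × Rd d => q k p.1 p.2)
    (hY : ∀ k, Measurable fun p : (ℕ → Rd d) × Rd d => Y k p.1 p.2) (n : ℕ) :
    Measurable (centeredSum q Y n) :=
  Finset.measurable_fun_sum _ fun k _ =>
    ((hY k).comp (measurable_id.prodMk (measurable_pi_apply (k + 1)))).sub
      (measurable_condMean (hq k) (hY k))

theorem isAdaptedAt_centeredSum (hq : ∀ k, IsAdaptedAt k (q k)) (hY : ∀ k, IsAdaptedAt k (Y k))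
    (n : ℕ) : IsAdaptedAt n (centeredSum q Y n) := by
  intro s s' hs
  refine Finset.sum_congr rfl fun k hk => ?_
  rw [Finset.mem_range] at hk
  rw [hq k s s' fun i hi hi' => hs i hi (by omega), hY k s s' fun i hi hi' => hs i hi (by omega),
    hs (k + 1) (by omega) (by omega)]

/-- Induction on `n`: the sum up to time `n` is a function of the first `n` particles, so
integrating out particle `n + 1` costs one factor `exp (u² b M)`, uniformly in the past. -/
theorem lintegral_exp_centeredSum_le [IsProbabilityMeasure μ] (hμ : IsPathPolicy μ q)
    (hq : ∀ k, Measurable fun p : (ℕ → Rd d) × Rd d => q k p.1 p.2)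
    (hq_dens : ∀ k s, IsDensity (q k s)) (hq_adapt : ∀ k, IsAdaptedAt k (q k))
    (hY : ∀ k, Measurable fun p : (ℕ → Rd d) × Rd d => Y k p.1 p.2)
    (hY_adapt : ∀ k, IsAdaptedAt k (Y k)) {n : ℕ} (hY0 : ∀ k s y, 0 ≤ Y k s y)
    (hYb : ∀ k < n, ∀ s y, Y k s y ≤ b) (hM : ∀ k < n, ∀ s, ∫ y, Y k s y * q k s y ≤ M)
    {u : ℝ} (hu : |u| * b ≤ 1) :
    ∫⁻ s, ENNReal.ofReal (Real.exp (u * centeredSum q Y n s)) ∂μ ≤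
      ENNReal.ofReal (Real.exp (n * (u ^ 2 * b * M))) := by
  induction n with
  | zero => simp [centeredSum]
  | succ n ih =>
    have ih := ih (fun k hk => hYb k (by omega)) (fun k hk => hM k (by omega))
    -- Past and new particle are separated into two arguments so that the policy identity applies;
    -- by adaptedness, truncating the path changes nothing.
    set g : (ℕ → Rd d) × Rd d → ENNReal := fun p =>
      ENNReal.ofReal (Real.exp (u * centeredSum q Y n p.1)) *
        ENNReal.ofReal (Real.exp (u * (Y n p.1 p.2 - ∫ y, Y n p.1 y * q n p.1 y))) with hg
    have hgm : Measurable g := by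
      have h1 : Measurable fun p : (ℕ → Rd d) × Rd d => centeredSum q Y n p.1 :=
        (measurable_centeredSum hq hY n).comp measurable_fst
      have h2 : Measurable fun p : (ℕ → Rd d) × Rd d => ∫ y, Y n p.1 y * q n p.1 y :=
        (measurable_condMean (hq n) (hY n)).comp measurable_fst
      exact (h1.const_mul u).exp.ennreal_ofReal.mul
        (((hY n).sub h2).const_mul u).exp.ennreal_ofReal
    have hgt : ∀ s y, g (truncatePath n s, y) = g (s, y) := fun s y => by
      simp only [hg, (isAdaptedAt_centeredSum hq_adapt hY_adapt n).truncatePath le_rfl,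
        (hY_adapt n).truncatePath le_rfl, (hq_adapt n).truncatePath le_rfl]
    have h1 : ∀ s, ENNReal.ofReal (Real.exp (u * centeredSum q Y (n + 1) s)) =
        g (truncatePath n s, s (n + 1)) := fun s => by
      rw [hgt, hg, centeredSum, Finset.sum_range_succ, mul_add, Real.exp_add,
        ENNReal.ofReal_mul (Real.exp_pos _).le]
      rfl
    simp_rw [h1]
    rw [hμ n g hgm]
    calc ∫⁻ s, (∫⁻ y, g (truncatePath n s, y) * ENNReal.ofReal (q n s y)) ∂μ
        ≤ ∫⁻ s, ENNReal.ofReal (Real.exp (u * centeredSum q Y n s)) *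
            ENNReal.ofReal (Real.exp (u ^ 2 * b * M)) ∂μ := by
          refine lintegral_mono fun s => ?_
          simp only [hgt]
          have h2 : ∀ y, g (s, y) * ENNReal.ofReal (q n s y) =
              ENNReal.ofReal (Real.exp (u * centeredSum q Y n s)) *
                (ENNReal.ofReal (Real.exp (u * (Y n s y - ∫ z, Y n s z * q n s z))) *
                  ENNReal.ofReal (q n s y)) := fun y => mul_assoc _ _ _
          simp only [h2]
          have hYs : Measurable (Y n s) := (hY n).comp measurable_prodMk_left
          rw [lintegral_const_mul]
          · gcongr
            exact lintegral_exp_mul_density_le (hq_dens n s) hYs (hY0 n s)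
              (hYb n (by omega) s) (hM n (by omega) s) hu
          · exact ((hYs.sub_const _).const_mul u).exp.ennreal_ofReal.mul
              (hq_dens n s).measurable.ennreal_ofReal
      _ ≤ ENNReal.ofReal (Real.exp (n * (u ^ 2 * b * M))) *
            ENNReal.ofReal (Real.exp (u ^ 2 * b * M)) := by
          rw [lintegral_mul_const _
            ((measurable_centeredSum hq hY n).const_mul u).exp.ennreal_ofReal]
          gcongr
      _ = ENNReal.ofReal (Real.exp ((n + 1 : ℕ) * (u ^ 2 * b * M))) := by
          rw [← ENNReal.ofReal_mul (Real.exp_pos _).le, ← Real.exp_add]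
          push_cast
          ring_nf

/-- Bernstein inequality for bounded nonnegative variables with bounded conditional means. -/
theorem measure_abs_centeredSum_ge_le [IsProbabilityMeasure μ] (hμ : IsPathPolicy μ q)
    (hq : ∀ k, Measurable fun p : (ℕ → Rd d) × Rd d => q k p.1 p.2)
    (hq_dens : ∀ k s, IsDensity (q k s)) (hq_adapt : ∀ k, IsAdaptedAt k (q k))
    (hY : ∀ k, Measurable fun p : (ℕ → Rd d) × Rd d => Y k p.1 p.2)
    (hY_adapt : ∀ k, IsAdaptedAt k (Y k)) {n : ℕ} (hY0 : ∀ k s y, 0 ≤ Y k s y)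
    (hYb : ∀ k < n, ∀ s y, Y k s y ≤ b) (hM : ∀ k < n, ∀ s, ∫ y, Y k s y * q k s y ≤ M)
    (hb : 0 < b) (hM0 : 0 < M) {ε : ℝ} (hε : 0 < ε) :
    μ {s | n * ε ≤ |centeredSum q Y n s|} ≤
      ENNReal.ofReal (2 * Real.exp (-(min 1 (ε / (2 * M)) * ε / 2 * (n / b)))) := by
  -- The Chernoff parameter is `τ / b`. The cap 1 keeps `|u| b ≤ 1`, and `ε / (2M)` makes the
  -- quadratic term at most half of the linear one.
  set τ := min 1 (ε / (2 * M)) with hτ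
  have hτ0 : 0 < τ := lt_min one_pos (by positivity)
  have hτ1 : τ ≤ 1 := min_le_left _ _
  have hτM : τ * M ≤ ε / 2 := by
    have : τ ≤ ε / (2 * M) := min_le_right _ _
    calc τ * M ≤ ε / (2 * M) * M := by gcongr
      _ = ε / 2 := by field_simp
  have hexp : n * ((τ / b) ^ 2 * b * M) - τ / b * (n * ε) ≤ -(τ * ε / 2 * (n / b)) := by
    have h1 : n * ((τ / b) ^ 2 * b * M) = τ * (n / b) * (τ * M) := by field_simp
    have h2 : τ / b * (n * ε) = τ * (n / b) * ε := by field_simp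
    rw [h1, h2]
    have : τ * (n / b) * (τ * M) ≤ τ * (n / b) * (ε / 2) := by gcongr
    linarith
  have hone : ∀ u : ℝ, |u| = τ / b →
      μ {s | n * ε * (τ / b) ≤ u * centeredSum q Y n s} ≤
        ENNReal.ofReal (Real.exp (-(τ * ε / 2 * (n / b)))) := by
    intro u hu
    have hub : |u| * b ≤ 1 := by rw [hu, div_mul_cancel₀ _ hb.ne']; exact hτ1
    have hmgf := lintegral_exp_centeredSum_le hμ hq hq_dens hq_adapt hY hY_adapt hY0 hYb hM hub
    have hmeas : Measurable fun s => ENNReal.ofReal (Real.exp (u * centeredSum q Y n s)) :=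
      ((measurable_centeredSum hq hY n).const_mul u).exp.ennreal_ofReal
    have hset : {s | n * ε * (τ / b) ≤ u * centeredSum q Y n s} ⊆
        {s | ENNReal.ofReal (Real.exp (n * ε * (τ / b))) ≤
          ENNReal.ofReal (Real.exp (u * centeredSum q Y n s))} := fun s hs =>
      ENNReal.ofReal_le_ofReal (Real.exp_le_exp.2 hs)
    refine (measure_mono hset).trans ?_
    refine (meas_ge_le_lintegral_div hmeas.aemeasurable
      (by simp [Real.exp_pos]) ENNReal.ofReal_ne_top).trans ?_
    refine (ENNReal.div_le_div_right hmgf _).trans ?_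
    rw [← ENNReal.ofReal_div_of_pos (Real.exp_pos _), ← Real.exp_sub, ← sq_abs u, hu]
    exact ENNReal.ofReal_le_ofReal (Real.exp_le_exp.2 (by linarith))
  have hpos : 0 ≤ τ / b := by positivity
  have hsub : {s | n * ε ≤ |centeredSum q Y n s|} ⊆
      {s | n * ε * (τ / b) ≤ (τ / b) * centeredSum q Y n s} ∪
        {s | n * ε * (τ / b) ≤ -(τ / b) * centeredSum q Y n s} := by
    intro s hs
    rcases le_abs.1 (Set.mem_ofPred_eq ▸ hs) with h1 | h1
    · left
      have := mul_le_mul_of_nonneg_right h1 hpos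
      simp only [Set.mem_ofPred_eq]; linarith
    · right
      have := mul_le_mul_of_nonneg_right h1 hpos
      simp only [Set.mem_ofPred_eq]; linarith
  calc μ {s | n * ε ≤ |centeredSum q Y n s|}
      ≤ ENNReal.ofReal (Real.exp (-(τ * ε / 2 * (n / b)))) +
          ENNReal.ofReal (Real.exp (-(τ * ε / 2 * (n / b)))) :=
        (measure_mono hsub).trans ((measure_union_le _ _).trans (add_le_add
          (hone _ (abs_of_nonneg hpos)) (hone _ (by rw [abs_neg, abs_of_nonneg hpos]))))
    _ = _ := by
      rw [← ENNReal.ofReal_add (Real.exp_pos _).le (Real.exp_pos _).le, two_mul]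

end PathLaw

/-! ### Conditional means of the regularized weights and the bias. -/

section Bias

/-- When `q = 0` the left side vanishes, so the identity also needs `a = 0` there; the safe density
guarantees this in the application. -/
theorem div_rpow_mul_eq {a q t : ℝ} (ha : 0 ≤ a) (hq : 0 ≤ q) (haq : q = 0 → a = 0) (ht : 0 < t) :
    (a / q) ^ t * q = a ^ t * q ^ (1 - t) := by
  rcases hq.eq_or_lt with rfl | hq
  · simp [haq rfl, Real.zero_rpow ht.ne']
  · rw [Real.div_rpow ha hq.le, Real.rpow_sub hq, Real.rpow_one]
    ring

theorem rpow_mul_rpow_one_sub {a : ℝ} (ha : 0 ≤ a) (t : ℝ) : a ^ t * a ^ (1 - t) = a := by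
  rw [← Real.rpow_add' ha (by simp)]
  simp

theorem rpow_mul_le_div_rpow_mul {a q t r : ℝ} (ha : 0 ≤ a) (hr : 0 < r) (hq : r * a ≤ q)
    (ht : 0 < t) (ht1 : t ≤ 1) : r ^ (1 - t) * a ≤ (a / q) ^ t * q := by
  have hra : 0 ≤ r * a := mul_nonneg hr.le ha
  rw [div_rpow_mul_eq ha (hra.trans hq)
    (fun h0 => by rw [h0] at hq; exact le_antisymm (by nlinarith) ha) ht]
  calc r ^ (1 - t) * a = a ^ t * (r * a) ^ (1 - t) := by
        rw [Real.mul_rpow hr.le ha, mul_left_comm, rpow_mul_rpow_one_sub ha]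
    _ ≤ a ^ t * q ^ (1 - t) := by
        have : 0 ≤ 1 - t := by linarith
        gcongr

/-- Weighted AM–GM against the constant 1. The error is additive because near `a = 0` no multiple of
`a` dominates `a ^ t` when `t < 1`. -/
theorem rpow_le_add_one_sub {a t : ℝ} (ha : 0 ≤ a) (ht : 0 ≤ t) (ht1 : t ≤ 1) :
    a ^ t ≤ a + (1 - t) := by
  have := Real.geom_mean_le_arith_mean2_weighted ht (by linarith : 0 ≤ 1 - t) ha zero_le_one
    (by ring)
  rw [Real.one_rpow, mul_one, mul_one] at this
  nlinarith

theorem div_rpow_mul_le {a q t Q : ℝ} (ha : 0 ≤ a) (hq0 : 0 ≤ q) (haq : q = 0 → a = 0)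
    (hq : q ≤ Q) (ht : 0 < t) (ht1 : t ≤ 1) :
    (a / q) ^ t * q ≤ Q ^ (1 - t) * (a + (1 - t)) := by
  rw [div_rpow_mul_eq ha hq0 haq ht, mul_comm]
  have h1 : 0 ≤ 1 - t := by linarith
  have h2 := rpow_le_add_one_sub ha ht.le ht1
  have := Real.rpow_nonneg (hq0.trans hq) (1 - t)
  gcongr

/-- Weighted AM–GM between `a` and `q`. With two densities the right side is integrable with
integral 1, whereas the constant in `div_rpow_mul_le` is useful only against an integrable kernel.
-/
theorem div_rpow_mul_le_arith {a q t : ℝ} (ha : 0 ≤ a) (hq0 : 0 ≤ q) (haq : q = 0 → a = 0)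
    (ht : 0 < t) (ht1 : t ≤ 1) : (a / q) ^ t * q ≤ t * a + (1 - t) * q := by
  rw [div_rpow_mul_eq ha hq0 haq ht]
  exact Real.geom_mean_le_arith_mean2_weighted ht.le (by linarith) ha hq0 (by ring)

/-- The assumptions on the target, the safe density, the kernel and the sequences, with explicit
constants. -/
structure SraisAssumptions {d : ℕ} (f q₀ K : Rd d → ℝ) (lam h η : ℕ → ℝ)
    (L U B LK U₀ c δ CK rK : ℝ) : Prop where
  target : IsDensity f
  safe : IsDensity q₀
  seq : SequenceConditions d lam h η
  kernel : KernelRegularity K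
  target_lipschitz : ∀ x y, |f x - f y| ≤ L * ‖x - y‖
  L_nonneg : 0 ≤ L
  target_le : ∀ x, f x ≤ U
  kernel_le : ∀ u, K u ≤ B
  kernel_lipschitz : ∀ x u, |K (x + u) - K x| ≤ LK * ‖u‖
  LK_pos : 0 < LK
  safe_le : ∀ x, q₀ x ≤ U₀
  c_pos : 0 < c
  δ_pos : 0 < δ
  tail : ∀ x, c * (1 + ‖x‖ ^ δ) * f x ≤ q₀ x
  CK_pos : 0 < CK
  rK_pos : 0 < rK
  kernel_tail : ∀ x, K x ≤ CK * (1 + ‖x‖) ^ (-rK)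

variable {d : ℕ} {f q₀ K : Rd d → ℝ} {lam h η : ℕ → ℝ} {L U B LK U₀ c δ CK rK : ℝ}

namespace SraisAssumptions

theorem B_pos (A : SraisAssumptions f q₀ K lam h η L U B LK U₀ c δ CK rK) : 0 < B := by
  by_contra hB
  have hK0 : K = 0 := funext fun u =>
    le_antisymm ((A.kernel_le u).trans (not_lt.1 hB)) (A.kernel.nonneg u)
  have := A.kernel.integral_eq_one
  simp [hK0] at this

theorem U_nonneg (A : SraisAssumptions f q₀ K lam h η L U B LK U₀ c δ CK rK) : 0 ≤ U :=
  (A.target.nonneg 0).trans (A.target_le 0)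

theorem U₀_nonneg (A : SraisAssumptions f q₀ K lam h η L U B LK U₀ c δ CK rK) : 0 ≤ U₀ :=
  (A.safe.nonneg 0).trans (A.safe_le 0)

theorem safeWeight_pos (A : SraisAssumptions f q₀ K lam h η L U B LK U₀ c δ CK rK) (k : ℕ) :
    0 < safeWeight lam k := by
  unfold safeWeight
  split_ifs with hk
  · exact one_pos
  · exact (A.seq.lam_mem k (by omega)).1

/-- Monotonicity of `lam` lets a single `lam n` bound all weights entering the `n`-th estimate. -/
theorem lam_le_safeWeight (A : SraisAssumptions f q₀ K lam h η L U B LK U₀ c δ CK rK) {k n : ℕ}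
    (hkn : k < n) : lam n ≤ safeWeight lam k := by
  unfold safeWeight
  split_ifs with hk
  · exact (A.seq.lam_mem n (by omega)).2
  · exact A.seq.lam_antitone (Set.mem_Ici.2 (by omega)) (Set.mem_Ici.2 (by omega)) hkn.le

theorem proposal_nonneg (A : SraisAssumptions f q₀ K lam h η L U B LK U₀ c δ CK rK)
    (s : ℕ → Rd d) (k : ℕ) (y : Rd d) : 0 ≤ proposal f q₀ K lam h η s k y :=
  _root_.proposal_nonneg A.target.nonneg A.safe.nonneg A.kernel.nonneg A.seq.lam_mem A.seq.h_pos
    s k y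

theorem isDensity_proposal (A : SraisAssumptions f q₀ K lam h η L U B LK U₀ c δ CK rK)
    (k : ℕ) (s : ℕ → Rd d) : IsDensity (proposal f q₀ K lam h η s k) :=
  _root_.isDensity_proposal A.target A.safe A.kernel A.seq.lam_mem A.seq.h_pos s k

theorem measurable_proposal (A : SraisAssumptions f q₀ K lam h η L U B LK U₀ c δ CK rK)
    (k : ℕ) : Measurable fun p : (ℕ → Rd d) × Rd d => proposal f q₀ K lam h η p.1 k p.2 :=
  _root_.measurable_proposal A.target.measurable A.safe.measurable
    A.kernel.continuous.measurable k

theorem measurable_stepWeight (A : SraisAssumptions f q₀ K lam h η L U B LK U₀ c δ CK rK)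
    (k : ℕ) : Measurable fun p : (ℕ → Rd d) × Rd d => stepWeight f q₀ K lam h η k p.1 p.2 :=
  _root_.measurable_stepWeight A.target.measurable A.safe.measurable
    A.kernel.continuous.measurable k

theorem stepWeight_nonneg (A : SraisAssumptions f q₀ K lam h η L U B LK U₀ c δ CK rK)
    (k : ℕ) (s : ℕ → Rd d) (y : Rd d) : 0 ≤ stepWeight f q₀ K lam h η k s y :=
  Real.rpow_nonneg (div_nonneg (A.target.nonneg y) (A.proposal_nonneg s k y)) _

theorem safeWeight_tail_le_proposal
    (A : SraisAssumptions f q₀ K lam h η L U B LK U₀ c δ CK rK) (k : ℕ) (s : ℕ → Rd d)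
    (y : Rd d) :
    safeWeight lam k * (c * (1 + ‖y‖ ^ δ) * f y) ≤ proposal f q₀ K lam h η s k y :=
  (mul_le_mul_of_nonneg_left (A.tail y) (A.safeWeight_pos k).le).trans
    (safeWeight_mul_le_proposal A.target.nonneg A.safe.nonneg A.kernel.nonneg A.seq.lam_mem
      A.seq.h_pos s k y)

theorem safeWeight_mul_target_le_proposal
    (A : SraisAssumptions f q₀ K lam h η L U B LK U₀ c δ CK rK) (k : ℕ) (s : ℕ → Rd d)
    (y : Rd d) : c * safeWeight lam k * f y ≤ proposal f q₀ K lam h η s k y := by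
  refine le_trans ?_ (A.safeWeight_tail_le_proposal k s y)
  have h1 : 0 ≤ ‖y‖ ^ δ := Real.rpow_nonneg (norm_nonneg y) δ
  have h2 := mul_nonneg (mul_nonneg (mul_nonneg A.c_pos.le (A.safeWeight_pos k).le) h1)
    (A.target.nonneg y)
  linarith

theorem target_eq_zero (A : SraisAssumptions f q₀ K lam h η L U B LK U₀ c δ CK rK) {k : ℕ}
    {s : ℕ → Rd d} {y : Rd d} (h0 : proposal f q₀ K lam h η s k y = 0) : f y = 0 := by
  have h1 := A.safeWeight_mul_target_le_proposal k s y
  rw [h0] at h1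
  have h2 : 0 < c * safeWeight lam k := mul_pos A.c_pos (A.safeWeight_pos k)
  exact le_antisymm (by nlinarith) (A.target.nonneg y)

/-- The weights of the first `n` particles decay at infinity. -/
theorem stepWeight_le_rpow (A : SraisAssumptions f q₀ K lam h η L U B LK U₀ c δ CK rK)
    {k n : ℕ} (hkn : k < n) (s : ℕ → Rd d) (y : Rd d) :
    stepWeight f q₀ K lam h η k s y ≤ (1 / (c * lam n * (1 + ‖y‖ ^ δ))) ^ η (k + 1) := by
  have h1 : 0 ≤ ‖y‖ ^ δ := Real.rpow_nonneg (norm_nonneg y) δ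
  have hlam := (A.seq.lam_mem n (by omega)).1
  refine Real.rpow_le_rpow (div_nonneg (A.target.nonneg y) (A.proposal_nonneg s k y)) ?_
    (A.seq.η_mem _ (by omega)).1.le
  have hpos : 0 < c * lam n * (1 + ‖y‖ ^ δ) := by have := A.c_pos; positivity
  rcases (A.proposal_nonneg s k y).eq_or_lt with h0 | h0
  · rw [← h0, div_zero]; positivity
  · rw [div_le_div_iff₀ h0 hpos, one_mul]
    refine le_trans ?_ (A.safeWeight_tail_le_proposal k s y)
    have := mul_le_mul_of_nonneg_right (A.lam_le_safeWeight hkn)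
      (mul_nonneg (mul_nonneg A.c_pos.le (by positivity : 0 ≤ 1 + ‖y‖ ^ δ)) (A.target.nonneg y))
    linarith

theorem stepWeight_le (A : SraisAssumptions f q₀ K lam h η L U B LK U₀ c δ CK rK)
    {k n : ℕ} (hkn : k < n) (s : ℕ → Rd d) (y : Rd d) :
    stepWeight f q₀ K lam h η k s y ≤ max 1 (1 / c) / lam n := by
  have h1 : 0 ≤ ‖y‖ ^ δ := Real.rpow_nonneg (norm_nonneg y) δ
  have hc := A.c_pos
  obtain ⟨hlam, hlam1⟩ := A.seq.lam_mem n (by omega)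
  obtain ⟨hη, hη1⟩ := A.seq.η_mem (k + 1) (by omega)
  have hbase : 1 / (c * lam n * (1 + ‖y‖ ^ δ)) ≤ max 1 (1 / c) / lam n := by
    calc 1 / (c * lam n * (1 + ‖y‖ ^ δ)) ≤ 1 / (c * lam n) := by
          refine one_div_le_one_div_of_le (by positivity) ?_
          exact le_mul_of_one_le_right (by positivity) (by linarith)
      _ = 1 / c / lam n := by field_simp
      _ ≤ _ := div_le_div_of_nonneg_right (le_max_right _ _) hlam.le
  -- The maximum with 1 keeps the base at least 1, so that raising the exponent `η ≤ 1` to 1 only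
  -- enlarges the bound.
  have hone : 1 ≤ max 1 (1 / c) / lam n := by
    rw [le_div_iff₀ hlam, one_mul]
    exact hlam1.trans (le_max_left _ _)
  calc stepWeight f q₀ K lam h η k s y
      ≤ (1 / (c * lam n * (1 + ‖y‖ ^ δ))) ^ η (k + 1) := A.stepWeight_le_rpow hkn s y
    _ ≤ (max 1 (1 / c) / lam n) ^ η (k + 1) := by
        refine Real.rpow_le_rpow ?_ hbase hη.le
        positivity
    _ ≤ (max 1 (1 / c) / lam n) ^ (1 : ℝ) := Real.rpow_le_rpow_of_exponent_le hone hη1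
    _ = _ := Real.rpow_one _

end SraisAssumptions

/-- The factor in the lower bound `lowerFactor k * f ≤ f ^ η * q ^ (1 - η)`. -/
noncomputable def lowerFactor (c : ℝ) (lam η : ℕ → ℝ) (k : ℕ) : ℝ :=
  (c * safeWeight lam k) ^ (1 - η (k + 1))

/-- The factor in the upper bound `f ^ η * q ^ (1 - η) ≤ upperFactor k * (f + (1 - η))`. -/
noncomputable def upperFactor (d : ℕ) (B U₀ : ℝ) (h η : ℕ → ℝ) (k : ℕ) : ℝ :=
  (B / h (k + 1) ^ d + U₀) ^ (1 - η (k + 1))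

namespace SraisAssumptions

theorem lowerFactor_nonneg (A : SraisAssumptions f q₀ K lam h η L U B LK U₀ c δ CK rK) (k : ℕ) :
    0 ≤ lowerFactor c lam η k :=
  Real.rpow_nonneg (mul_nonneg A.c_pos.le (A.safeWeight_pos k).le) _

theorem upperFactor_nonneg (A : SraisAssumptions f q₀ K lam h η L U B LK U₀ c δ CK rK) (k : ℕ) :
    0 ≤ upperFactor d B U₀ h η k := by
  have := A.B_pos
  have := A.U₀_nonneg
  have := A.seq.h_pos (k + 1) (by omega)
  unfold upperFactor
  positivity

theorem tendsto_one_sub_η (A : SraisAssumptions f q₀ K lam h η L U B LK U₀ c δ CK rK) :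
    Tendsto (fun k => 1 - η (k + 1)) atTop (𝓝 0) := by
  simpa using (A.seq.η_tendsto.comp (tendsto_add_atTop_nat 1)).const_sub 1

/-- The logarithm is `(1 - η_{k+1}) (log c + log λ_k)` for `k ≥ 1`, which is the condition `η_lam`
after a shift of index. -/
theorem tendsto_lowerFactor (A : SraisAssumptions f q₀ K lam h η L U B LK U₀ c δ CK rK) :
    Tendsto (lowerFactor c lam η) atTop (𝓝 1) := by
  have h1 : Tendsto (fun k => (1 - η (k + 1)) * Real.log (lam k)) atTop (𝓝 0) :=
    A.seq.η_lam.comp (tendsto_add_atTop_nat 1)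
  have h2 : Tendsto (fun k => Real.exp ((1 - η (k + 1)) * Real.log c +
      (1 - η (k + 1)) * Real.log (lam k))) atTop (𝓝 1) := by
    have := (A.tendsto_one_sub_η.mul_const (Real.log c)).add h1
    rw [zero_mul, zero_add] at this
    simpa [Function.comp_def] using (Real.continuous_exp.tendsto 0).comp this
  refine h2.congr' ?_
  filter_upwards [eventually_ge_atTop 1] with k hk
  have hl := (A.seq.lam_mem k hk).1
  unfold lowerFactor safeWeight
  rw [if_neg (by omega), Real.rpow_def_of_pos (mul_pos A.c_pos hl),
    Real.log_mul A.c_pos.ne' hl.ne']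
  ring_nf

/-- Pulling out `h^(-d)` leaves `B + U₀ h^d`, whose logarithm converges because `B > 0`; the rest of
the exponent is controlled by `η_h`. -/
theorem tendsto_upperFactor (A : SraisAssumptions f q₀ K lam h η L U B LK U₀ c δ CK rK) :
    Tendsto (upperFactor d B U₀ h η) atTop (𝓝 1) := by
  have hB := A.B_pos
  have hU := A.U₀_nonneg
  have h1 : Tendsto (fun k => (1 - η (k + 1)) * Real.log (h (k + 1))) atTop (𝓝 0) :=
    A.seq.η_h.comp (tendsto_add_atTop_nat 1)
  have h2 : Tendsto (fun k => Real.log (B + U₀ * h (k + 1) ^ d)) atTop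
      (𝓝 (Real.log (B + U₀ * 0 ^ d))) := by
    refine Tendsto.log ?_ (by positivity)
    exact (((A.seq.h_tendsto.comp (tendsto_add_atTop_nat 1)).pow d).const_mul U₀).const_add B
  have h3 : Tendsto (fun k => Real.exp ((1 - η (k + 1)) * Real.log (B + U₀ * h (k + 1) ^ d) -
      d * ((1 - η (k + 1)) * Real.log (h (k + 1))))) atTop (𝓝 1) := by
    have := (A.tendsto_one_sub_η.mul h2).sub (h1.const_mul (d : ℝ))
    rw [zero_mul, mul_zero, sub_zero] at this
    simpa [Function.comp_def] using (Real.continuous_exp.tendsto 0).comp this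
  refine h3.congr fun k => ?_
  have hh := A.seq.h_pos (k + 1) (by omega)
  have h4 : B / h (k + 1) ^ d + U₀ = (B + U₀ * h (k + 1) ^ d) / h (k + 1) ^ d := by field_simp
  unfold upperFactor
  rw [h4, Real.rpow_def_of_pos (by positivity), Real.log_div (by positivity) (by positivity),
    Real.log_pow]
  ring_nf

theorem lowerFactor_mul_le (A : SraisAssumptions f q₀ K lam h η L U B LK U₀ c δ CK rK) (k : ℕ)
    (s : ℕ → Rd d) (y : Rd d) :
    lowerFactor c lam η k * f y ≤
      stepWeight f q₀ K lam h η k s y * proposal f q₀ K lam h η s k y :=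
  rpow_mul_le_div_rpow_mul (A.target.nonneg y) (mul_pos A.c_pos (A.safeWeight_pos k))
    (A.safeWeight_mul_target_le_proposal k s y) (A.seq.η_mem _ (by omega)).1
    (A.seq.η_mem _ (by omega)).2

theorem stepWeight_mul_le (A : SraisAssumptions f q₀ K lam h η L U B LK U₀ c δ CK rK) (k : ℕ)
    (s : ℕ → Rd d) (y : Rd d) :
    stepWeight f q₀ K lam h η k s y * proposal f q₀ K lam h η s k y ≤
      upperFactor d B U₀ h η k * (f y + (1 - η (k + 1))) :=
  div_rpow_mul_le (A.target.nonneg y) (A.proposal_nonneg s k y) A.target_eq_zero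
    (proposal_le A.target.nonneg A.safe.nonneg A.kernel.nonneg A.kernel_le A.safe_le
      A.seq.lam_mem A.seq.h_pos A.seq.h_antitone s k y)
    (A.seq.η_mem _ (by omega)).1 (A.seq.η_mem _ (by omega)).2

theorem stepWeight_mul_le_arith (A : SraisAssumptions f q₀ K lam h η L U B LK U₀ c δ CK rK)
    (k : ℕ) (s : ℕ → Rd d) (y : Rd d) :
    stepWeight f q₀ K lam h η k s y * proposal f q₀ K lam h η s k y ≤
      η (k + 1) * f y + (1 - η (k + 1)) * proposal f q₀ K lam h η s k y :=
  div_rpow_mul_le_arith (A.target.nonneg y) (A.proposal_nonneg s k y) A.target_eq_zero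
    (A.seq.η_mem _ (by omega)).1 (A.seq.η_mem _ (by omega)).2

theorem integrable_stepWeight_mul (A : SraisAssumptions f q₀ K lam h η L U B LK U₀ c δ CK rK)
    (k : ℕ) (s : ℕ → Rd d) :
    Integrable fun y => stepWeight f q₀ K lam h η k s y * proposal f q₀ K lam h η s k y := by
  refine Integrable.mono' ((A.target.integrable.const_mul (η (k + 1))).add
    ((A.isDensity_proposal k s).integrable.const_mul (1 - η (k + 1)))) ?_ ?_
  · have h1 : Measurable fun y => stepWeight f q₀ K lam h η k s y :=
      (A.measurable_stepWeight k).comp measurable_prodMk_left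
    exact (h1.mul (A.isDensity_proposal k s).measurable).aestronglyMeasurable
  · refine Eventually.of_forall fun y => ?_
    rw [Real.norm_of_nonneg (mul_nonneg (A.stepWeight_nonneg k s y) (A.proposal_nonneg s k y))]
    exact A.stepWeight_mul_le_arith k s y

/-- The conditional mean of a regularized weight is close to `1`. -/
theorem abs_condMean_stepWeight_sub_one_le
    (A : SraisAssumptions f q₀ K lam h η L U B LK U₀ c δ CK rK) (k : ℕ) (s : ℕ → Rd d) :
    ∫ y, stepWeight f q₀ K lam h η k s y * proposal f q₀ K lam h η s k y ≤ 1 ∧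
    |(∫ y, stepWeight f q₀ K lam h η k s y * proposal f q₀ K lam h η s k y) - 1| ≤
      |lowerFactor c lam η k - 1| := by
  have hq := A.isDensity_proposal k s
  have h1 : ∫ y, stepWeight f q₀ K lam h η k s y * proposal f q₀ K lam h η s k y ≤ 1 := by
    refine (integral_mono (A.integrable_stepWeight_mul k s)
      ((A.target.integrable.const_mul (η (k + 1))).add (hq.integrable.const_mul (1 - η (k + 1))))
      (A.stepWeight_mul_le_arith k s)).trans ?_
    rw [integral_add' (A.target.integrable.const_mul _) (hq.integrable.const_mul _),
      integral_const_mul, integral_const_mul, A.target.integral_eq_one, hq.integral_eq_one]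
    linarith
  have h2 : lowerFactor c lam η k ≤
      ∫ y, stepWeight f q₀ K lam h η k s y * proposal f q₀ K lam h η s k y := by
    have := integral_mono (A.target.integrable.const_mul (lowerFactor c lam η k))
      (A.integrable_stepWeight_mul k s) (A.lowerFactor_mul_le k s)
    rwa [integral_const_mul, A.target.integral_eq_one, mul_one] at this
  refine ⟨h1, ?_⟩
  rw [abs_of_nonpos (by linarith), abs_of_nonpos (by linarith)]
  linarith

end SraisAssumptions

/-! ### Smoothing by the scaled kernel and uniform bias bounds. -/

theorem integrable_scaledKernel_sub (hK : KernelRegularity K) {r : ℝ} (hr : 0 < r) (x : Rd d) :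
    Integrable fun y => scaledKernel K r (x - y) :=
  (integrable_scaledKernel hK hr).comp_sub_left x

theorem integral_scaledKernel_sub (hK : KernelRegularity K) {r : ℝ} (hr : 0 < r) (x : Rd d) :
    ∫ y, scaledKernel K r (x - y) = 1 := by
  rw [integral_sub_left_eq_self (scaledKernel K r), integral_scaledKernel hK hr]

theorem norm_mul_scaledKernel {r : ℝ} (hr : 0 < r) (u : Rd d) :
    ‖u‖ * scaledKernel K r u = r / r ^ d * (‖r⁻¹ • u‖ * K (r⁻¹ • u)) := by
  unfold scaledKernel
  rw [norm_smul, Real.norm_of_nonneg (inv_nonneg.2 hr.le)]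
  field_simp

theorem integrable_norm_mul_scaledKernel (hK : KernelRegularity K) {r : ℝ} (hr : 0 < r) :
    Integrable fun u => ‖u‖ * scaledKernel K r u := by
  simp_rw [norm_mul_scaledKernel hr]
  exact (hK.integrable_norm_mul.comp_smul (inv_ne_zero hr.ne')).const_mul _

theorem integral_norm_mul_scaledKernel {r : ℝ} (hr : 0 < r) :
    ∫ u, ‖u‖ * scaledKernel K r u = r * ∫ u, ‖u‖ * K u := by
  simp_rw [norm_mul_scaledKernel hr]
  rw [integral_const_mul, Measure.integral_comp_smul volume (fun u => ‖u‖ * K u)]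
  have : 0 < r ^ d := pow_pos hr d
  simp [abs_of_pos hr]
  field_simp

namespace SraisAssumptions

theorem measurable_scaledKernel (A : SraisAssumptions f q₀ K lam h η L U B LK U₀ c δ CK rK)
    (r : ℝ) : Measurable (scaledKernel K r) :=
  (A.kernel.continuous.measurable.comp (measurable_id.const_smul r⁻¹)).div_const _

theorem integrable_target_mul_scaledKernel
    (A : SraisAssumptions f q₀ K lam h η L U B LK U₀ c δ CK rK) {r : ℝ} (hr : 0 < r) (x : Rd d) :
    Integrable fun y => f y * scaledKernel K r (x - y) :=
  (integrable_scaledKernel_sub A.kernel hr x).bdd_mul A.target.measurable.aestronglyMeasurable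
    (Eventually.of_forall fun y => by
      rw [Real.norm_of_nonneg (A.target.nonneg y)]; exact A.target_le y)

/-- As `K_r` has mass one, the difference is `∫ (f y - f x) K_r(x - y)`; the Lipschitz bound leaves
the first absolute moment of `K_r`, which is `r` times that of `K`. -/
theorem abs_smoothing_sub_le (A : SraisAssumptions f q₀ K lam h η L U B LK U₀ c δ CK rK) {r : ℝ}
    (hr : 0 < r) (x : Rd d) :
    |(∫ y, f y * scaledKernel K r (x - y)) - f x| ≤ L * (r * ∫ u, ‖u‖ * K u) := by
  have h1 : (∫ y, f y * scaledKernel K r (x - y)) - f x =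
      ∫ y, (f y * scaledKernel K r (x - y) - f x * scaledKernel K r (x - y)) := by
    rw [integral_sub (A.integrable_target_mul_scaledKernel hr x)
      ((integrable_scaledKernel_sub A.kernel hr x).const_mul _), integral_const_mul,
      integral_scaledKernel_sub A.kernel hr, mul_one]
  rw [h1]
  have h2 : ∫ y, L * (‖x - y‖ * scaledKernel K r (x - y)) = L * (r * ∫ u, ‖u‖ * K u) := by
    rw [integral_const_mul, integral_sub_left_eq_self (fun u => ‖u‖ * scaledKernel K r u),
      integral_norm_mul_scaledKernel hr]
  rw [← h2, ← Real.norm_eq_abs]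
  refine norm_integral_le_of_norm_le
    (((integrable_norm_mul_scaledKernel A.kernel hr).comp_sub_left x).const_mul L)
    (Eventually.of_forall fun y => ?_)
  have h3 := scaledKernel_nonneg A.kernel.nonneg hr.le (x - y)
  rw [← sub_mul, Real.norm_eq_abs, abs_mul, abs_of_nonneg h3, ← mul_assoc]
  refine mul_le_mul_of_nonneg_right ?_ h3
  rw [← norm_neg (x - y), neg_sub]
  exact A.target_lipschitz y x

theorem smoothing_le (A : SraisAssumptions f q₀ K lam h η L U B LK U₀ c δ CK rK) {r : ℝ}
    (hr : 0 < r) (x : Rd d) : ∫ y, f y * scaledKernel K r (x - y) ≤ U := by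
  have h1 := integral_mono (A.integrable_target_mul_scaledKernel hr x)
    ((integrable_scaledKernel_sub A.kernel hr x).const_mul U) fun y =>
    mul_le_mul_of_nonneg_right (A.target_le y) (scaledKernel_nonneg A.kernel.nonneg hr.le (x - y))
  rwa [integral_const_mul, integral_scaledKernel_sub A.kernel hr, mul_one] at h1

/-- Two-sided bounds for the conditional mean of a weighted kernel. -/
theorem condMean_kernel_bounds (A : SraisAssumptions f q₀ K lam h η L U B LK U₀ c δ CK rK)
    {r : ℝ} (hr : 0 < r) (k : ℕ) (s : ℕ → Rd d) (x : Rd d) :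
    lowerFactor c lam η k * (∫ y, f y * scaledKernel K r (x - y)) ≤
      ∫ y, stepWeight f q₀ K lam h η k s y * scaledKernel K r (x - y) *
        proposal f q₀ K lam h η s k y ∧
    ∫ y, stepWeight f q₀ K lam h η k s y * scaledKernel K r (x - y) *
        proposal f q₀ K lam h η s k y ≤
      upperFactor d B U₀ h η k *
        ((∫ y, f y * scaledKernel K r (x - y)) + (1 - η (k + 1))) := by
  have h0 : ∀ y, stepWeight f q₀ K lam h η k s y * scaledKernel K r (x - y) *
        proposal f q₀ K lam h η s k y = scaledKernel K r (x - y) *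
        (stepWeight f q₀ K lam h η k s y * proposal f q₀ K lam h η s k y) := fun y => by ring
  simp_rw [h0]
  have hnn : ∀ y, 0 ≤ scaledKernel K r (x - y) := fun y =>
    scaledKernel_nonneg A.kernel.nonneg hr.le (x - y)
  have hint : Integrable fun y => scaledKernel K r (x - y) *
        (stepWeight f q₀ K lam h η k s y * proposal f q₀ K lam h η s k y) :=
    (A.integrable_stepWeight_mul k s).bdd_mul (c := B / r ^ d)
      ((A.measurable_scaledKernel r).comp (measurable_const.sub measurable_id)).aestronglyMeasurable
      (Eventually.of_forall fun y => by
        rw [Real.norm_of_nonneg (hnn y)]; exact scaledKernel_le A.kernel_le hr _)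
  have hfK := A.integrable_target_mul_scaledKernel hr x
  have hK := integrable_scaledKernel_sub A.kernel hr x
  constructor
  · rw [← integral_const_mul]
    refine integral_mono (hfK.const_mul _) hint fun y => ?_
    have := mul_le_mul_of_nonneg_left (A.lowerFactor_mul_le k s y) (hnn y)
    simp only
    linarith
  · have h1 : upperFactor d B U₀ h η k *
        ((∫ y, f y * scaledKernel K r (x - y)) + (1 - η (k + 1))) =
        ∫ y, upperFactor d B U₀ h η k *
          (f y * scaledKernel K r (x - y) + (1 - η (k + 1)) * scaledKernel K r (x - y)) := by
      rw [integral_const_mul, integral_add hfK (hK.const_mul _), integral_const_mul,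
        integral_scaledKernel_sub A.kernel hr, mul_one]
    rw [h1]
    refine integral_mono hint ((hfK.add (hK.const_mul _)).const_mul _) fun y => ?_
    have := mul_le_mul_of_nonneg_left (A.stepWeight_mul_le k s y) (hnn y)
    simp only
    linarith

/-- A uniform bound for the conditional means of the weighted kernels. -/
theorem exists_condMean_kernel_le
    (A : SraisAssumptions f q₀ K lam h η L U B LK U₀ c δ CK rK) :
    ∃ M : ℝ, 0 < M ∧ ∀ r : ℝ, 0 < r → ∀ k s x,
      ∫ y, stepWeight f q₀ K lam h η k s y * scaledKernel K r (x - y) *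
        proposal f q₀ K lam h η s k y ≤ M := by
  obtain ⟨R, hR⟩ := A.tendsto_upperFactor.bddAbove_range
  have hR' : ∀ k, upperFactor d B U₀ h η k ≤ max R 1 := fun k =>
    (hR ⟨k, rfl⟩).trans (le_max_left _ _)
  have hU := A.U_nonneg
  have hR1 : (0 : ℝ) < max R 1 := lt_max_of_lt_right one_pos
  refine ⟨max R 1 * (U + 1), by positivity, fun r hr k s x => ?_⟩
  refine (A.condMean_kernel_bounds hr k s x).2.trans ?_
  have hη := A.seq.η_mem (k + 1) (by omega)
  have h1 : (∫ y, f y * scaledKernel K r (x - y)) + (1 - η (k + 1)) ≤ U + 1 := by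
    linarith [A.smoothing_le hr x]
  calc _ ≤ upperFactor d B U₀ h η k * (U + 1) :=
        mul_le_mul_of_nonneg_left h1 (A.upperFactor_nonneg k)
    _ ≤ _ := mul_le_mul_of_nonneg_right (hR' k) (by linarith)

/-- The averaged conditional means of the weighted kernels converge to the target, uniformly. -/
theorem exists_average_bias_le
    (A : SraisAssumptions f q₀ K lam h η L U B LK U₀ c δ CK rK) :
    ∃ β : ℕ → ℝ, Tendsto β atTop (𝓝 0) ∧ ∀ n, 1 ≤ n → ∀ s x,
      |(∑ k ∈ Finset.range n, ∫ y, stepWeight f q₀ K lam h η k s y *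
        scaledKernel K (h n) (x - y) * proposal f q₀ K lam h η s k y) - n * f x| ≤ n * β n := by
  set σ := lowerFactor c lam η
  set ρ := upperFactor d B U₀ h η
  -- Two errors: `D n` comes from smoothing at bandwidth `h n`, while `a k` comes from the factors
  -- at step `k` and vanishes only after Cesàro averaging.
  set D : ℕ → ℝ := fun n => L * (h n * ∫ u, ‖u‖ * K u)
  set a : ℕ → ℝ := fun k => (|ρ k - 1| + |σ k - 1|) * U + ρ k * (1 - η (k + 1))
  have hU := A.U_nonneg
  have hD0 : ∀ n, 1 ≤ n → 0 ≤ D n := fun n hn =>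
    (abs_nonneg _).trans (A.abs_smoothing_sub_le (A.seq.h_pos n hn) 0)
  obtain ⟨R, hR⟩ := A.tendsto_upperFactor.bddAbove_range
  obtain ⟨R', hR'⟩ := A.tendsto_lowerFactor.bddAbove_range
  have hσ1 : Tendsto (fun k => |σ k - 1|) atTop (𝓝 0) := by
    simpa using (A.tendsto_lowerFactor.sub_const 1).abs
  have hρ1 : Tendsto (fun k => |ρ k - 1|) atTop (𝓝 0) := by
    simpa using (A.tendsto_upperFactor.sub_const 1).abs
  have ha : Tendsto a atTop (𝓝 0) := by
    simpa using ((hρ1.add hσ1).mul_const U).add (A.tendsto_upperFactor.mul A.tendsto_one_sub_η)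
  have hD : Tendsto D atTop (𝓝 0) := by
    simpa using (A.seq.h_tendsto.mul_const (∫ u, ‖u‖ * K u)).const_mul L
  refine ⟨fun n => (n : ℝ)⁻¹ * ∑ k ∈ Finset.range n, a k + (R + R') * D n, ?_, ?_⟩
  · simpa using ha.cesaro.add (hD.const_mul (R + R'))
  · intro n hn s x
    have hn0 : (n : ℝ) ≠ 0 := by positivity
    have hstep : ∀ k, |(∫ y, stepWeight f q₀ K lam h η k s y *
        scaledKernel K (h n) (x - y) * proposal f q₀ K lam h η s k y) - f x| ≤
          a k + (R + R') * D n := by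
      intro k
      obtain ⟨h1, h2⟩ := A.condMean_kernel_bounds (A.seq.h_pos n hn) k s x
      obtain ⟨h3, h4⟩ := abs_le.1 (A.abs_smoothing_sub_le (A.seq.h_pos n hn) x)
      set J := ∫ y, f y * scaledKernel K (h n) (x - y)
      have hη := A.seq.η_mem (k + 1) (by omega)
      have hσ0 : 0 ≤ σ k := A.lowerFactor_nonneg k
      have hρ0 : 0 ≤ ρ k := A.upperFactor_nonneg k
      have hfx0 := A.target.nonneg x
      have hfx := A.target_le x
      have hρR : ρ k ≤ R := hR ⟨k, rfl⟩
      have hσR : σ k ≤ R' := hR' ⟨k, rfl⟩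
      have h5 : ρ k * J ≤ ρ k * (f x + D n) := mul_le_mul_of_nonneg_left (by linarith) hρ0
      have h6 : σ k * (f x - D n) ≤ σ k * J := mul_le_mul_of_nonneg_left (by linarith) hσ0
      have h7 : (ρ k - 1) * f x ≤ |ρ k - 1| * U :=
        mul_le_mul (le_abs_self _) hfx hfx0 (abs_nonneg _)
      have h8 : -(σ k - 1) * f x ≤ |σ k - 1| * U :=
        mul_le_mul (neg_le_abs _) hfx hfx0 (abs_nonneg _)
      have h9 : ρ k * D n ≤ R * D n := mul_le_mul_of_nonneg_right hρR (hD0 n hn)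
      have h10 : σ k * D n ≤ R' * D n := mul_le_mul_of_nonneg_right hσR (hD0 n hn)
      have h11 : 0 ≤ ρ k * D n := mul_nonneg hρ0 (hD0 n hn)
      have h12 : 0 ≤ σ k * D n := mul_nonneg hσ0 (hD0 n hn)
      have h13 : 0 ≤ ρ k * (1 - η (k + 1)) := mul_nonneg hρ0 (by linarith [hη.2])
      have h14 : 0 ≤ |ρ k - 1| * U := by positivity
      have h15 : 0 ≤ |σ k - 1| * U := by positivity
      simp only [a]
      rw [abs_le]
      constructor <;> linarith
    have hsum : (∑ k ∈ Finset.range n, ∫ y, stepWeight f q₀ K lam h η k s y *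
        scaledKernel K (h n) (x - y) * proposal f q₀ K lam h η s k y) - n * f x =
        ∑ k ∈ Finset.range n, ((∫ y, stepWeight f q₀ K lam h η k s y *
        scaledKernel K (h n) (x - y) * proposal f q₀ K lam h η s k y) - f x) := by
      rw [Finset.sum_sub_distrib]; simp
    rw [hsum]
    refine (Finset.abs_sum_le_sum_abs _ _).trans
      ((Finset.sum_le_sum fun k _ => hstep k).trans (le_of_eq ?_))
    rw [Finset.sum_add_distrib, Finset.sum_const, Finset.card_range, nsmul_eq_mul]
    field_simp

end SraisAssumptions

end Bias

/-! ### Borel–Cantelli, grids, and uniform control on finite families. -/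

section Uniform

theorem ae_eventually_notMem_of_eventually_le {α : Type*} [MeasurableSpace α] {μ : Measure α}
    {s : ℕ → Set α} {u : ℕ → ℝ} (hu : Summable u) (hs : ∀ᶠ n in atTop, μ (s n) ≤ ENNReal.ofReal (u n)) :
    ∀ᵐ x ∂μ, ∀ᶠ n in atTop, x ∉ s n := by
  obtain ⟨N, hN⟩ := eventually_atTop.1 hs
  have h1 : ∑' n, μ (s (n + N)) ≠ ⊤ := by
    refine ne_top_of_le_ne_top ((summable_nat_add_iff N).2 hu).tsum_ofReal_ne_top ?_
    exact ENNReal.tsum_le_tsum fun n => hN (n + N) (by omega)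
  filter_upwards [ae_eventually_notMem h1] with x hx
  obtain ⟨N', hN'⟩ := eventually_atTop.1 hx
  refine eventually_atTop.2 ⟨N' + N, fun n hn => ?_⟩
  have := hN' (n - N) (by omega)
  rwa [Nat.sub_add_cancel (by omega)] at this

/-- The hypothesis says that `a n` eventually exceeds every multiple of `log n`; here the multiple
`(p + 2) / κ` is enough. -/
theorem eventually_pow_mul_exp_le {a : ℕ → ℝ} (ha : ∀ n, 1 ≤ n → 0 < a n)
    (hlog : Tendsto (fun n : ℕ => Real.log n / a n) atTop (𝓝 0)) {κ : ℝ} (hκ : 0 < κ) (p : ℕ) :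
    ∀ᶠ n : ℕ in atTop, (n : ℝ) ^ p * Real.exp (-(κ * a n)) ≤ 1 / (n : ℝ) ^ 2 := by
  have h1 : ∀ᶠ n : ℕ in atTop, Real.log n / a n < κ / (p + 2) :=
    hlog.eventually_lt_const (by positivity)
  filter_upwards [h1, eventually_ge_atTop 1] with n hn hn1
  have hn0 : (0 : ℝ) < n := by positivity
  have han := ha n hn1
  rw [div_lt_div_iff₀ han (by positivity)] at hn
  have h2 : Real.exp (-(κ * a n)) ≤ 1 / (n : ℝ) ^ (p + 2) := by
    rw [Real.exp_neg, ← one_div]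
    refine one_div_le_one_div_of_le (by positivity) ?_
    rw [← Real.log_le_iff_le_exp (by positivity), Real.log_pow]
    push_cast
    linarith
  calc (n : ℝ) ^ p * Real.exp (-(κ * a n)) ≤ (n : ℝ) ^ p * (1 / (n : ℝ) ^ (p + 2)) := by gcongr
    _ = 1 / (n : ℝ) ^ 2 := by rw [pow_add]; field_simp

variable {d : ℕ}

/-- Almost surely, the centered sums of finite families of polynomial size are eventually
negligible. -/
theorem ae_eventually_forall_abs_centeredSum_lt {ι : Type*} {μ : Measure (ℕ → Rd d)}
    [IsProbabilityMeasure μ] {q : ℕ → (ℕ → Rd d) → Rd d → ℝ} (hμ : IsPathPolicy μ q)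
    (hq : ∀ k, Measurable fun p : (ℕ → Rd d) × Rd d => q k p.1 p.2)
    (hq_dens : ∀ k s, IsDensity (q k s)) (hq_adapt : ∀ k, IsAdaptedAt k (q k))
    {Y : ℕ → ι → ℕ → (ℕ → Rd d) → Rd d → ℝ}
    (hY : ∀ n i k, Measurable fun p : (ℕ → Rd d) × Rd d => Y n i k p.1 p.2)
    (hY_adapt : ∀ n i k, IsAdaptedAt k (Y n i k))
    (hY0 : ∀ n, 1 ≤ n → ∀ i k s y, 0 ≤ Y n i k s y) {C M : ℝ} {w : ℕ → ℝ}
    (hYb : ∀ n i, ∀ k < n, ∀ s y, Y n i k s y ≤ C / w n)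
    (hM : ∀ n i, ∀ k < n, ∀ s, ∫ y, Y n i k s y * q k s y ≤ M) (hC : 0 < C) (hM0 : 0 < M)
    (hw : ∀ n, 1 ≤ n → 0 < w n)
    (hrate : Tendsto (fun n : ℕ => Real.log n / (n * w n)) atTop (𝓝 0))
    {G : ℕ → Finset ι} {C' p : ℕ} (hG : ∀ n, 1 ≤ n → (G n).card ≤ C' * n ^ p)
    {ε : ℝ} (hε : 0 < ε) :
    ∀ᵐ s ∂μ, ∀ᶠ n : ℕ in atTop, ∀ i ∈ G n, |centeredSum q (Y n i) n s| < n * ε := by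
  set κ := min 1 (ε / (2 * M)) * ε / 2 with hκ
  have hκ0 : 0 < κ := by
    have : 0 < min 1 (ε / (2 * M)) := lt_min one_pos (by positivity)
    positivity
  have hsum : Summable fun n : ℕ => 2 * (C' : ℝ) * (1 / (n : ℝ) ^ 2) :=
    (Real.summable_one_div_nat_pow.2 one_lt_two).mul_left _
  have hexp := eventually_pow_mul_exp_le (a := fun n => n * w n)
    (fun n hn => by have := hw n hn; positivity) hrate (by positivity : 0 < κ / C) p
  -- Union bound over `G n`: its polynomial cardinality is absorbed by the Bernstein tail, leaving a
  -- summable `n^(-2)`.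
  have hbad : ∀ᶠ n : ℕ in atTop,
      μ (⋃ i ∈ G n, {s | n * ε ≤ |centeredSum q (Y n i) n s|}) ≤
        ENNReal.ofReal (2 * (C' : ℝ) * (1 / (n : ℝ) ^ 2)) := by
    filter_upwards [hexp, eventually_ge_atTop 1] with n hn hn1
    have hwn := hw n hn1
    calc μ (⋃ i ∈ G n, {s | n * ε ≤ |centeredSum q (Y n i) n s|})
        ≤ ∑ i ∈ G n, μ {s | n * ε ≤ |centeredSum q (Y n i) n s|} :=
          measure_biUnion_finset_le _ _
      _ ≤ ∑ i ∈ G n, ENNReal.ofReal (2 * Real.exp (-(κ / C * (n * w n)))) := by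
          refine Finset.sum_le_sum fun i _ => ?_
          have := measure_abs_centeredSum_ge_le hμ hq hq_dens hq_adapt (hY n i) (hY_adapt n i)
            (hY0 n hn1 i) (hYb n i) (hM n i) (by positivity) hM0 hε
          have h1 : κ * (n / (C / w n)) = κ / C * (n * w n) := by field_simp
          rwa [← hκ, h1] at this
      _ = ENNReal.ofReal ((G n).card * (2 * Real.exp (-(κ / C * (n * w n))))) := by
          rw [Finset.sum_const, nsmul_eq_mul, ← ENNReal.ofReal_natCast,
            ← ENNReal.ofReal_mul (by positivity)]
      _ ≤ _ := by
          refine ENNReal.ofReal_le_ofReal ?_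
          have h2 : ((G n).card : ℝ) ≤ C' * (n : ℝ) ^ p := by exact_mod_cast hG n hn1
          calc ((G n).card : ℝ) * (2 * Real.exp (-(κ / C * (n * w n))))
              ≤ C' * (n : ℝ) ^ p * (2 * Real.exp (-(κ / C * (n * w n)))) := by gcongr
            _ = 2 * C' * ((n : ℝ) ^ p * Real.exp (-(κ / C * (n * w n)))) := by ring
            _ ≤ _ := by gcongr
  filter_upwards [ae_eventually_notMem_of_eventually_le hsum hbad] with s hs
  filter_upwards [hs] with n hn i hi
  by_contra hlt
  exact hn (Set.mem_biUnion hi (not_lt.1 hlt))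

/-- A grid of mesh `1 / m` covering the ball of radius `R`. -/
theorem exists_grid (d R m : ℕ) :
    ∃ G : Finset (Rd d), G.card ≤ (2 * (R * m) + 1) ^ d ∧
      (0 < m → ∀ x : Rd d, ‖x‖ ≤ R → ∃ g ∈ G, ‖x - g‖ ≤ d / m) := by
  classical
  refine ⟨(Fintype.piFinset fun _ : Fin d => Finset.Icc (-((R * m : ℕ) : ℤ)) (R * m : ℕ)).image
    fun z => WithLp.toLp 2 fun i => (z i : ℝ) / m, ?_, ?_⟩
  · refine Finset.card_image_le.trans ?_
    rw [Fintype.card_piFinset_const, Int.card_Icc]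
    refine Nat.pow_le_pow_left ?_ d
    omega
  · intro hm x hx
    have hm0 : (0 : ℝ) < m := by exact_mod_cast hm
    -- Rounding each coordinate down to a multiple of `1 / m` costs at most `√d / m` in norm,
    -- bounded crudely by `d / m`.
    refine ⟨WithLp.toLp 2 fun i => (⌊x i * m⌋ : ℝ) / m, ?_, ?_⟩
    · refine Finset.mem_image.2 ⟨fun i => ⌊x i * m⌋, ?_, rfl⟩
      rw [Fintype.mem_piFinset]
      intro i
      have hxi : |x i| ≤ R := (PiLp.norm_apply_le x i).trans hx
      rw [abs_le] at hxi
      rw [Finset.mem_Icc]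
      constructor
      · rw [Int.le_floor]
        push_cast
        nlinarith
      · have h1 : (⌊x i * m⌋ : ℝ) ≤ ((R * m : ℕ) : ℤ) := by
          refine (Int.floor_le _).trans ?_
          push_cast
          nlinarith
        exact_mod_cast h1
    · rw [EuclideanSpace.norm_eq]
      have h2 : ∀ i : Fin d, ‖(x - WithLp.toLp 2 fun i => (⌊x i * m⌋ : ℝ) / m) i‖ ^ 2 ≤
          (1 / (m : ℝ)) ^ 2 := by
        intro i
        refine pow_le_pow_left₀ (norm_nonneg _) ?_ 2
        have h3 := Int.floor_le (x i * m)
        have h4 := Int.lt_floor_add_one (x i * m)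
        have h5 : (x - WithLp.toLp 2 fun i => (⌊x i * m⌋ : ℝ) / m) i =
            (x i * m - ⌊x i * m⌋) / m := by
          rw [PiLp.sub_apply]
          field_simp
        rw [h5, Real.norm_of_nonneg (div_nonneg (by linarith) hm0.le)]
        exact div_le_div_of_nonneg_right (by linarith) hm0.le
      rw [Real.sqrt_le_left (by positivity)]
      refine (Finset.sum_le_sum fun i _ => h2 i).trans ?_
      rw [Finset.sum_const, Finset.card_univ, Fintype.card_fin, nsmul_eq_mul, div_pow, div_pow,
        one_pow, mul_one_div]
      refine div_le_div_of_nonneg_right ?_ (by positivity)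
      have h6 : d ≤ d ^ 2 := Nat.le_self_pow (by norm_num) d
      exact_mod_cast h6

variable {f q₀ K : Rd d → ℝ} {lam h η : ℕ → ℝ} {L U B LK U₀ c δ CK rK : ℝ}

/-- The unnormalized weighted kernel estimate. -/
noncomputable def weightedKernelSum (f q₀ K : Rd d → ℝ) (lam h η : ℕ → ℝ) (s : ℕ → Rd d) (n : ℕ)
    (x : Rd d) : ℝ :=
  ∑ k ∈ Finset.range n,
    stepWeight f q₀ K lam h η k s (s (k + 1)) * scaledKernel K (h n) (x - s (k + 1))

/-- The sum of the regularized weights of the first `n` particles. -/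
noncomputable def weightSum (f q₀ K : Rd d → ℝ) (lam h η : ℕ → ℝ) (s : ℕ → Rd d) (n : ℕ) : ℝ :=
  ∑ k ∈ Finset.range n, stepWeight f q₀ K lam h η k s (s (k + 1))

/-- Once the weight sum is nonzero, the convention of equal weights `1/n` plays no role. -/
theorem sraisEstimate_eq_div {s : ℕ → Rd d} {n : ℕ} (x : Rd d)
    (h0 : weightSum f q₀ K lam h η s n ≠ 0) :
    sraisEstimate f q₀ K lam h η s n x =
      weightedKernelSum f q₀ K lam h η s n x / weightSum f q₀ K lam h η s n := by
  have h1 : ∑ k ∈ Finset.Icc 1 n, regWeight f η (proposal f q₀ K lam h η s) s k =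
      weightSum f q₀ K lam h η s n := sum_Icc_one_eq_sum_range _ n
  unfold sraisEstimate kernelEstimate normWeight
  simp only [h1, if_neg h0]
  rw [sum_Icc_one_eq_sum_range, weightedKernelSum, Finset.sum_div]
  exact Finset.sum_congr rfl fun k _ => div_mul_eq_mul_div _ _ _

namespace SraisAssumptions

theorem ae_eventually_abs_weightSum_sub_lt
    (A : SraisAssumptions f q₀ K lam h η L U B LK U₀ c δ CK rK) {μ : Measure (ℕ → Rd d)}
    [IsProbabilityMeasure μ]
    (hμ : IsPathPolicy μ fun k s => proposal f q₀ K lam h η s k) {ε : ℝ} (hε : 0 < ε) :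
    ∀ᵐ s ∂μ, ∀ᶠ n : ℕ in atTop, |weightSum f q₀ K lam h η s n - n| < n * ε := by
  -- A one-point family: without a kernel factor the bound is a constant over `lam n`, so `lam_rate`
  -- suffices.
  have hconc := ae_eventually_forall_abs_centeredSum_lt (ι := Unit) hμ A.measurable_proposal
    A.isDensity_proposal (fun k s s' hs => proposal_congr hs)
    (Y := fun _ _ k => stepWeight f q₀ K lam h η k) (fun _ _ k => A.measurable_stepWeight k)
    (fun _ _ k s s' hs => stepWeight_congr hs) (fun _ _ _ k => A.stepWeight_nonneg k)
    (w := lam) (fun n _ k hk s y => A.stepWeight_le hk s y)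
    (fun _ _ k _ s => (A.abs_condMean_stepWeight_sub_one_le k s).1)
    (lt_max_of_lt_left one_pos) one_pos (fun n hn => (A.seq.lam_mem n hn).1) A.seq.lam_rate
    (G := fun _ => {()}) (C' := 1) (p := 0) (fun n _ => by simp) (half_pos hε)
  have hces : Tendsto (fun n : ℕ => (n : ℝ)⁻¹ *
      ∑ k ∈ Finset.range n, |lowerFactor c lam η k - 1|) atTop (𝓝 0) := by
    have h1 : Tendsto (fun k => |lowerFactor c lam η k - 1|) atTop (𝓝 0) := by
      simpa using (A.tendsto_lowerFactor.sub_const 1).abs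
    exact h1.cesaro
  filter_upwards [hconc] with s hs
  filter_upwards [hs, hces.eventually_lt_const (half_pos hε), eventually_ge_atTop 1]
    with n hn hn2 hn1
  have hn0 : (0 : ℝ) < n := by positivity
  have h1 := hn () (by simp)
  rw [inv_mul_lt_iff₀ hn0] at hn2
  have h2 : weightSum f q₀ K lam h η s n - n =
      centeredSum (fun k s => proposal f q₀ K lam h η s k) (stepWeight f q₀ K lam h η) n s +
      ∑ k ∈ Finset.range n,
        ((∫ y, stepWeight f q₀ K lam h η k s y * proposal f q₀ K lam h η s k y) - 1) := by
    unfold weightSum centeredSum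
    rw [← Finset.sum_add_distrib]
    simp
  have h3 := (Finset.abs_sum_le_sum_abs (fun k =>
      (∫ y, stepWeight f q₀ K lam h η k s y * proposal f q₀ K lam h η s k y) - 1)
      (Finset.range n)).trans
    (Finset.sum_le_sum fun k _ => (A.abs_condMean_stepWeight_sub_one_le k s).2)
  rw [h2]
  refine (abs_add_le _ _).trans_lt ?_
  linarith

/-- Fluctuation plus bias, half of `ε` each. The bias holds for all paths and points, so only the
fluctuation restricts `x` to the grid. -/
theorem ae_eventually_forall_abs_weightedKernelSum_sub_lt
    (A : SraisAssumptions f q₀ K lam h η L U B LK U₀ c δ CK rK) {μ : Measure (ℕ → Rd d)}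
    [IsProbabilityMeasure μ]
    (hμ : IsPathPolicy μ fun k s => proposal f q₀ K lam h η s k)
    {G : ℕ → Finset (Rd d)} {C' p : ℕ} (hG : ∀ n, 1 ≤ n → (G n).card ≤ C' * n ^ p)
    {ε : ℝ} (hε : 0 < ε) :
    ∀ᵐ s ∂μ, ∀ᶠ n : ℕ in atTop, ∀ x ∈ G n,
      |weightedKernelSum f q₀ K lam h η s n x - n * f x| < n * ε := by
  obtain ⟨M, hM0, hM⟩ := A.exists_condMean_kernel_le
  obtain ⟨β, hβ, hbias⟩ := A.exists_average_bias_le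
  have hB := A.B_pos
  have hCw : 0 < max 1 (1 / c) := lt_max_of_lt_left one_pos
  have hrate : Tendsto (fun n : ℕ => Real.log n / (n * (h n ^ d * lam n))) atTop (𝓝 0) := by
    simpa only [mul_assoc] using A.seq.h_rate
  have hconc := ae_eventually_forall_abs_centeredSum_lt (ι := Rd d) hμ A.measurable_proposal
    A.isDensity_proposal (fun k s s' hs => proposal_congr hs)
    (Y := fun n x k s y => stepWeight f q₀ K lam h η k s y * scaledKernel K (h n) (x - y))
    (fun n x k => (A.measurable_stepWeight k).mul
      ((A.measurable_scaledKernel (h n)).comp (measurable_const.sub measurable_snd)))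
    (fun n x k s s' hs => by simp only [stepWeight_congr hs])
    (fun n hn x k s y => mul_nonneg (A.stepWeight_nonneg k s y)
      (scaledKernel_nonneg A.kernel.nonneg (A.seq.h_pos n hn).le _))
    (C := max 1 (1 / c) * B) (w := fun n => h n ^ d * lam n)
    (fun n x k hk s y => by
      have hh := A.seq.h_pos n (by omega)
      have hl := (A.seq.lam_mem n (by omega)).1
      calc _ ≤ max 1 (1 / c) / lam n * (B / h n ^ d) :=
            mul_le_mul (A.stepWeight_le hk s y) (scaledKernel_le A.kernel_le hh _)
              (scaledKernel_nonneg A.kernel.nonneg hh.le _) (by positivity)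
        _ = _ := by field_simp)
    (fun n x k hk s => hM (h n) (A.seq.h_pos n (by omega)) k s x)
    (by positivity) hM0
    (fun n hn => mul_pos (pow_pos (A.seq.h_pos n hn) d) (A.seq.lam_mem n hn).1)
    hrate hG (half_pos hε)
  filter_upwards [hconc] with s hs
  filter_upwards [hs, hβ.eventually_lt_const (half_pos hε), eventually_ge_atTop 1]
    with n hn hn2 hn1 x hx
  have hn0 : (0 : ℝ) < n := by positivity
  have h1 := hn x hx
  have h2 := hbias n hn1 s x
  have h3 : weightedKernelSum f q₀ K lam h η s n x - n * f x =
      centeredSum (fun k s => proposal f q₀ K lam h η s k)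
        (fun k s y => stepWeight f q₀ K lam h η k s y * scaledKernel K (h n) (x - y)) n s +
      ((∑ k ∈ Finset.range n, ∫ y, stepWeight f q₀ K lam h η k s y *
        scaledKernel K (h n) (x - y) * proposal f q₀ K lam h η s k y) - n * f x) := by
    unfold weightedKernelSum centeredSum
    rw [Finset.sum_sub_distrib]
    ring
  have h4 := mul_lt_mul_of_pos_left hn2 hn0
  rw [h3]
  refine (abs_add_le _ _).trans_lt ?_
  linarith

end SraisAssumptions

end Uniform

/-! ### Passing from the grid to the whole space, and normalization. -/

section Convergence

variable {d : ℕ} {f q₀ K : Rd d → ℝ} {lam h η : ℕ → ℝ} {L U B LK U₀ c δ CK rK : ℝ}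

theorem abs_scaledKernel_sub_le {K : Rd d → ℝ} {LK r : ℝ}
    (hK : ∀ x u, |K (x + u) - K x| ≤ LK * ‖u‖) (hr : 0 < r) (u v : Rd d) :
    |scaledKernel K r u - scaledKernel K r v| ≤ LK * ‖u - v‖ / (r * r ^ d) := by
  have h1 := hK (r⁻¹ • v) (r⁻¹ • (u - v))
  rw [← smul_add, add_sub_cancel, norm_smul, Real.norm_of_nonneg (inv_nonneg.2 hr.le)] at h1
  unfold scaledKernel
  rw [← sub_div, abs_div, abs_of_pos (pow_pos hr d)]
  calc _ ≤ LK * (r⁻¹ * ‖u - v‖) / r ^ d := div_le_div_of_nonneg_right h1 (pow_pos hr d).le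
    _ = _ := by field_simp

namespace SraisAssumptions

/-- Once `log n ≥ 1`, the rate condition bounds the inverses of the bandwidth and mixture parameters
by `n`. Such crude polynomial bounds suffice off the grid, since mesh and radius may be arbitrary
powers of `n`. -/
theorem eventually_le_one_and_rate
    (A : SraisAssumptions f q₀ K lam h η L U B LK U₀ c δ CK rK) :
    ∀ᶠ n : ℕ in atTop, h n ≤ 1 ∧ 1 / (h n ^ d * lam n) ≤ n := by
  have h1 := A.seq.h_tendsto.eventually_le_const (u := 1) one_pos
  have h2 := A.seq.h_rate.eventually_le_const (u := 1) one_pos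
  have h3 : ∀ᶠ n : ℕ in atTop, 1 ≤ Real.log n :=
    (Real.tendsto_log_atTop.comp tendsto_natCast_atTop_atTop).eventually_ge_atTop 1
  filter_upwards [h1, h2, h3, eventually_ge_atTop 1] with n hn1 hn2 hn3 hn
  have hh := A.seq.h_pos n hn
  have hl := (A.seq.lam_mem n hn).1
  have hn0 : (0 : ℝ) < n := by positivity
  refine ⟨hn1, ?_⟩
  rw [div_le_one (by positivity)] at hn2
  rw [div_le_iff₀ (by positivity)]
  linarith

theorem one_div_h_le (A : SraisAssumptions f q₀ K lam h η L U B LK U₀ c δ CK rK) (hd : 1 ≤ d)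
    {n : ℕ} (hn : 1 ≤ n) (hh1 : h n ≤ 1) (hrate : 1 / (h n ^ d * lam n) ≤ n) : 1 / h n ≤ n := by
  have hh := A.seq.h_pos n hn
  obtain ⟨hl, hl1⟩ := A.seq.lam_mem n hn
  refine le_trans (one_div_le_one_div_of_le (by positivity) ?_) hrate
  calc h n ^ d * lam n ≤ h n ^ 1 * 1 := by
        refine mul_le_mul (pow_le_pow_of_le_one hh.le hh1 hd) hl1 hl.le (by positivity)
    _ = h n := by ring

theorem one_div_lam_le (A : SraisAssumptions f q₀ K lam h η L U B LK U₀ c δ CK rK)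
    {n : ℕ} (hn : 1 ≤ n) (hh1 : h n ≤ 1) (hrate : 1 / (h n ^ d * lam n) ≤ n) :
    1 / lam n ≤ n := by
  have hh := A.seq.h_pos n hn
  have hl := (A.seq.lam_mem n hn).1
  refine le_trans (one_div_le_one_div_of_le (by positivity) ?_) hrate
  exact mul_le_of_le_one_left hl.le (pow_le_one₀ hh.le hh1)

theorem one_div_h_pow_le (A : SraisAssumptions f q₀ K lam h η L U B LK U₀ c δ CK rK)
    {n : ℕ} (hn : 1 ≤ n) (hrate : 1 / (h n ^ d * lam n) ≤ n) : 1 / h n ^ d ≤ n := by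
  have hh := A.seq.h_pos n hn
  obtain ⟨hl, hl1⟩ := A.seq.lam_mem n hn
  refine le_trans (one_div_le_one_div_of_le (by positivity) ?_) hrate
  exact mul_le_of_le_one_right (by positivity) hl1

/-- Each summand is Lipschitz with constant of order `1 / (λ_n h_n^(d+1))`, hence at most of order
`n²`. -/
theorem abs_weightedKernelSum_sub_le
    (A : SraisAssumptions f q₀ K lam h η L U B LK U₀ c δ CK rK) (hd : 1 ≤ d)
    {n : ℕ} (hn : 1 ≤ n) (hh1 : h n ≤ 1) (hrate : 1 / (h n ^ d * lam n) ≤ n) (s : ℕ → Rd d)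
    (x g : Rd d) :
    |weightedKernelSum f q₀ K lam h η s n x - weightedKernelSum f q₀ K lam h η s n g| ≤
      n * (max 1 (1 / c) * LK * n ^ 2 * ‖x - g‖) := by
  have hh := A.seq.h_pos n hn
  have hl := (A.seq.lam_mem n hn).1
  have hLK := A.LK_pos
  have hC : 0 < max 1 (1 / c) := lt_max_of_lt_left one_pos
  have hterm : ∀ k ∈ Finset.range n,
      |stepWeight f q₀ K lam h η k s (s (k + 1)) * scaledKernel K (h n) (x - s (k + 1)) -
        stepWeight f q₀ K lam h η k s (s (k + 1)) * scaledKernel K (h n) (g - s (k + 1))| ≤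
      max 1 (1 / c) * LK * n ^ 2 * ‖x - g‖ := by
    intro k hk
    have hk := Finset.mem_range.1 hk
    rw [← mul_sub, abs_mul, abs_of_nonneg (A.stepWeight_nonneg k s _)]
    have h1 := abs_scaledKernel_sub_le A.kernel_lipschitz hh (x - s (k + 1)) (g - s (k + 1))
    rw [sub_sub_sub_cancel_right] at h1
    calc _ ≤ max 1 (1 / c) / lam n * (LK * ‖x - g‖ / (h n * h n ^ d)) :=
          mul_le_mul (A.stepWeight_le hk s _) h1 (abs_nonneg _) (by positivity)
      _ = max 1 (1 / c) * LK * ‖x - g‖ * ((1 / (h n ^ d * lam n)) * (1 / h n)) := by field_simp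
      _ ≤ max 1 (1 / c) * LK * ‖x - g‖ * (n * n) := by
          gcongr
          exact A.one_div_h_le hd hn hh1 hrate
      _ = _ := by ring
  unfold weightedKernelSum
  rw [← Finset.sum_sub_distrib]
  refine (Finset.abs_sum_le_sum_abs _ _).trans ((Finset.sum_le_sum hterm).trans (le_of_eq ?_))
  rw [Finset.sum_const, Finset.card_range, nsmul_eq_mul]

theorem weightedKernelSum_nonneg
    (A : SraisAssumptions f q₀ K lam h η L U B LK U₀ c δ CK rK) {n : ℕ} (hn : 1 ≤ n)
    (s : ℕ → Rd d) (x : Rd d) : 0 ≤ weightedKernelSum f q₀ K lam h η s n x :=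
  Finset.sum_nonneg fun k _ => mul_nonneg (A.stepWeight_nonneg k s _)
    (scaledKernel_nonneg A.kernel.nonneg (A.seq.h_pos n hn).le _)

theorem target_le_of_le_norm (A : SraisAssumptions f q₀ K lam h η L U B LK U₀ c δ CK rK)
    {R : ℝ} (hR : 0 < R) {x : Rd d} (hx : R ≤ ‖x‖) : f x ≤ U₀ / c * (R ^ δ)⁻¹ := by
  have hc := A.c_pos
  have h1 : R ^ δ ≤ ‖x‖ ^ δ := Real.rpow_le_rpow hR.le hx A.δ_pos.le
  have h2 : 0 < R ^ δ := Real.rpow_pos_of_pos hR δ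
  have h3 : c * R ^ δ * f x ≤ U₀ := by
    refine le_trans ?_ ((A.tail x).trans (A.safe_le x))
    have := A.target.nonneg x
    gcongr
    linarith
  rw [← div_eq_mul_inv, div_div, le_div_iff₀ (by positivity)]
  linarith

/-- The regularization exponents are bounded away from `0`. -/
theorem exists_le_η (A : SraisAssumptions f q₀ K lam h η L U B LK U₀ c δ CK rK) :
    ∃ η₀ : ℝ, 0 < η₀ ∧ ∀ k, 1 ≤ k → η₀ ≤ η k := by
  have h1 : Tendsto (fun k => (η k)⁻¹) atTop (𝓝 1) := by
    simpa using A.seq.η_tendsto.inv₀ one_ne_zero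
  obtain ⟨R, hR⟩ := h1.bddAbove_range
  have hR1 : (0 : ℝ) < max R 1 := lt_max_of_lt_right one_pos
  refine ⟨(max R 1)⁻¹, inv_pos.2 hR1, fun k hk => ?_⟩
  have hη := (A.seq.η_mem k hk).1
  rw [inv_le_comm₀ hR1 hη]
  exact (hR ⟨k, rfl⟩).trans (le_max_left _ _)

/-- If the kernel is evaluated far from the particle, its value is small. -/
theorem scaledKernel_le_of_le_norm (A : SraisAssumptions f q₀ K lam h η L U B LK U₀ c δ CK rK)
    {r R : ℝ} (hr : 0 < r) (hr1 : r ≤ 1) (hR : 0 < R) {u : Rd d} (hu : R ≤ ‖u‖) :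
    scaledKernel K r u ≤ CK * R ^ (-rK) / r ^ d := by
  have hCK := A.CK_pos
  refine div_le_div_of_nonneg_right ((A.kernel_tail _).trans ?_) (by positivity)
  refine mul_le_mul_of_nonneg_left ?_ hCK.le
  refine Real.rpow_le_rpow_of_nonpos hR ?_ (by linarith [A.rK_pos])
  rw [norm_smul, Real.norm_of_nonneg (inv_nonneg.2 hr.le)]
  have h1 : ‖u‖ ≤ r⁻¹ * ‖u‖ :=
    le_mul_of_one_le_left (norm_nonneg u) ((one_le_inv₀ hr).2 hr1)
  linarith

theorem rpow_natPow_inv_le {n A : ℕ} {t e : ℝ} (hn : 1 ≤ n) (hA : e ≤ A * t) :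
    (((n : ℝ) ^ A) ^ t)⁻¹ ≤ (n : ℝ) ^ (-e) := by
  have hn1 : (1 : ℝ) ≤ n := by exact_mod_cast hn
  rw [← Real.rpow_natCast, ← Real.rpow_mul (by positivity), ← Real.rpow_neg (by positivity)]
  exact Real.rpow_le_rpow_of_exponent_le hn1 (by linarith)

/-- Outside of a ball of large polynomial radius, the target and the weighted kernels are
uniformly small. -/
theorem exists_radius (A : SraisAssumptions f q₀ K lam h η L U B LK U₀ c δ CK rK) :
    ∃ (a : ℕ) (D : ℝ), ∀ᶠ n : ℕ in atTop, ∀ s x, (n : ℝ) ^ a ≤ ‖x‖ →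
      f x ≤ D / n ∧ weightedKernelSum f q₀ K lam h η s n x ≤ n * (D / n) := by
  obtain ⟨η₀, hη₀, hη⟩ := A.exists_le_η
  have hδ := A.δ_pos
  have hrK := A.rK_pos
  have hc := A.c_pos
  have hCK := A.CK_pos
  have hB := A.B_pos
  have hU₀ := A.U₀_nonneg
  have hCw : 0 < max 1 (1 / c) := lt_max_of_lt_left one_pos
  -- `a * rK ≥ 2` gives a kernel tail `n^(-2)`, enough against `1 / (h^d λ) ≤ n`. In `a * δ ≥ 2 +
  -- 2/η₀`, the 2 absorbs `1/λ ≤ n` and the constant `2^δ / c ≤ n`; the remaining `n^(-2/η₀)`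
  -- becomes at most `n^(-2)` after the power `η ≥ η₀`.
  obtain ⟨a, ha⟩ := exists_nat_ge (max (2 / rK) ((2 + 2 / η₀) / δ))
  have ha1 : 2 ≤ a * rK := by
    have := (le_max_left _ _).trans ha
    rwa [div_le_iff₀ hrK] at this
  have ha2 : 2 + 2 / η₀ ≤ a * δ := by
    have := (le_max_right _ _).trans ha
    rwa [div_le_iff₀ hδ] at this
  have hη₀' : 0 < 2 / η₀ := by positivity
  refine ⟨a, U₀ / c + max 1 (1 / c) * CK * 2 ^ rK + B, ?_⟩
  have hlarge : ∀ᶠ n : ℕ in atTop, 2 ^ δ / c ≤ (n : ℝ) :=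
    tendsto_natCast_atTop_atTop.eventually_ge_atTop _
  filter_upwards [A.eventually_le_one_and_rate, hlarge, eventually_ge_atTop 1]
    with n ⟨hh1, hrate⟩ hn2 hn s x hx
  have hh := A.seq.h_pos n hn
  have hl := (A.seq.lam_mem n hn).1
  have hn0 : (0 : ℝ) < n := by positivity
  have hn1 : (1 : ℝ) ≤ n := by exact_mod_cast hn
  have hE1 : 0 ≤ U₀ / c := by positivity
  have hE2 : 0 ≤ max 1 (1 / c) * CK * 2 ^ rK := by positivity
  have hRpos : (0 : ℝ) < (n : ℝ) ^ a := by positivity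
  constructor
  · calc f x ≤ U₀ / c * (((n : ℝ) ^ a) ^ δ)⁻¹ := A.target_le_of_le_norm hRpos hx
      _ ≤ U₀ / c * (n : ℝ) ^ (-(1 : ℝ)) := by
          gcongr
          exact rpow_natPow_inv_le hn (by linarith)
      _ = U₀ / c / n := by rw [Real.rpow_neg_one, ← div_eq_mul_inv]
      _ ≤ _ := by gcongr; linarith
  · have hterm : ∀ k ∈ Finset.range n,
        stepWeight f q₀ K lam h η k s (s (k + 1)) * scaledKernel K (h n) (x - s (k + 1)) ≤
          (U₀ / c + max 1 (1 / c) * CK * 2 ^ rK + B) / n := by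
      intro k hk
      have hk := Finset.mem_range.1 hk
      have hR2 : (0 : ℝ) < (n : ℝ) ^ a / 2 := by positivity
      have hKnn := scaledKernel_nonneg A.kernel.nonneg hh.le (x - s (k + 1))
      -- A particle in the half ball is far from `x`, so the kernel is small; a particle outside it
      -- has a small weight.
      rcases le_or_gt ‖s (k + 1)‖ ((n : ℝ) ^ a / 2) with hs | hs
      · have hu : (n : ℝ) ^ a / 2 ≤ ‖x - s (k + 1)‖ := by
          have := norm_sub_norm_le x (s (k + 1))
          linarith
        have h1 : ((n : ℝ) ^ a / 2) ^ (-rK) ≤ 2 ^ rK * (n : ℝ) ^ (-(2 : ℝ)) := by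
          rw [Real.rpow_neg hR2.le, Real.div_rpow hRpos.le zero_le_two, inv_div, div_eq_mul_inv]
          gcongr
          exact rpow_natPow_inv_le hn ha1
        calc _ ≤ max 1 (1 / c) / lam n * (CK * ((n : ℝ) ^ a / 2) ^ (-rK) / h n ^ d) :=
              mul_le_mul (A.stepWeight_le hk s _) (A.scaledKernel_le_of_le_norm hh hh1 hR2 hu)
                hKnn (by positivity)
          _ = max 1 (1 / c) * CK * ((n : ℝ) ^ a / 2) ^ (-rK) * (1 / (h n ^ d * lam n)) := by
              field_simp
          _ ≤ max 1 (1 / c) * CK * (2 ^ rK * (n : ℝ) ^ (-(2 : ℝ))) * n := by gcongr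
          _ = max 1 (1 / c) * CK * 2 ^ rK / n := by
              rw [Real.rpow_neg hn0.le, Real.rpow_two]
              field_simp
          _ ≤ _ := by gcongr; linarith
      · obtain ⟨hηk, hηk1⟩ := A.seq.η_mem (k + 1) (by omega)
        have h1 : (((n : ℝ) ^ a / 2) ^ δ)⁻¹ ≤ 2 ^ δ * (n : ℝ) ^ (-(2 + 2 / η₀)) := by
          rw [Real.div_rpow hRpos.le zero_le_two, inv_div, div_eq_mul_inv]
          gcongr
          exact rpow_natPow_inv_le hn ha2
        have h2 : 1 / (c * lam n * (1 + ‖s (k + 1)‖ ^ δ)) ≤ (n : ℝ) ^ (-(2 / η₀)) := by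
          have h3 : ((n : ℝ) ^ a / 2) ^ δ ≤ 1 + ‖s (k + 1)‖ ^ δ := by
            have := Real.rpow_le_rpow hR2.le hs.le hδ.le
            linarith
          calc _ ≤ 1 / (c * lam n * ((n : ℝ) ^ a / 2) ^ δ) := by gcongr
            _ = 1 / c * (1 / lam n) * (((n : ℝ) ^ a / 2) ^ δ)⁻¹ := by field_simp
            _ ≤ 1 / c * n * (2 ^ δ * (n : ℝ) ^ (-(2 + 2 / η₀))) := by
                gcongr
                exact A.one_div_lam_le hn hh1 hrate
            _ = 2 ^ δ / c * (n * (n : ℝ) ^ (-(2 + 2 / η₀))) := by ring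
            _ ≤ n * (n * (n : ℝ) ^ (-(2 + 2 / η₀))) := by gcongr
            _ = (n : ℝ) ^ (-(2 / η₀)) := by
                rw [neg_add, Real.rpow_add hn0, Real.rpow_neg hn0.le 2, Real.rpow_two]
                field_simp
        have h4 : stepWeight f q₀ K lam h η k s (s (k + 1)) ≤ (n : ℝ) ^ (-(2 : ℝ)) := by
          calc _ ≤ ((n : ℝ) ^ (-(2 / η₀))) ^ η (k + 1) := by
                refine (A.stepWeight_le_rpow hk s _).trans
                  (Real.rpow_le_rpow ?_ h2 hηk.le)
                have : 0 ≤ ‖s (k + 1)‖ ^ δ := Real.rpow_nonneg (norm_nonneg _) δ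
                positivity
            _ ≤ _ := by
                rw [← Real.rpow_mul hn0.le]
                refine Real.rpow_le_rpow_of_exponent_le hn1 ?_
                have h5 : 2 / η₀ * η₀ ≤ 2 / η₀ * η (k + 1) := by
                  gcongr
                  exact hη _ (by omega)
                rw [div_mul_cancel₀ _ hη₀.ne'] at h5
                linarith
        calc _ ≤ (n : ℝ) ^ (-(2 : ℝ)) * (B / h n ^ d) :=
              mul_le_mul h4 (scaledKernel_le A.kernel_le hh _) hKnn (by positivity)
          _ = (n : ℝ) ^ (-(2 : ℝ)) * B * (1 / h n ^ d) := by ring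
          _ ≤ (n : ℝ) ^ (-(2 : ℝ)) * B * n := by
              gcongr
              exact A.one_div_h_pow_le hn hrate
          _ = B / n := by
              rw [Real.rpow_neg hn0.le, Real.rpow_two]
              field_simp
          _ ≤ _ := by gcongr; linarith
    refine (Finset.sum_le_sum hterm).trans (le_of_eq ?_)
    rw [Finset.sum_const, Finset.card_range, nsmul_eq_mul]

/-- Almost surely, the unnormalized weighted kernel estimate converges uniformly. -/
theorem ae_eventually_forall_abs_weightedKernelSum_sub_le
    (A : SraisAssumptions f q₀ K lam h η L U B LK U₀ c δ CK rK) (hd : 1 ≤ d)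
    {μ : Measure (ℕ → Rd d)} [IsProbabilityMeasure μ]
    (hμ : IsPathPolicy μ fun k s => proposal f q₀ K lam h η s k) {ε : ℝ} (hε : 0 < ε) :
    ∀ᵐ s ∂μ, ∀ᶠ n : ℕ in atTop, ∀ x,
      |weightedKernelSum f q₀ K lam h η s n x - n * f x| ≤ n * ε := by
  obtain ⟨a, D, hfar⟩ := A.exists_radius
  -- The mesh `n^(-4)` beats the Lipschitz constant of order `n²`, and the number of grid points
  -- stays polynomial in `n`.
  choose G hcard hcover using fun n : ℕ => exists_grid d (n ^ a) (n ^ 4)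
  have hG : ∀ n, 1 ≤ n → (G n).card ≤ 3 ^ d * n ^ ((a + 4) * d) := by
    intro n hn
    refine (hcard n).trans ?_
    rw [pow_mul, ← mul_pow, ← pow_add]
    refine Nat.pow_le_pow_left ?_ d
    have : 1 ≤ n ^ (a + 4) := Nat.one_le_pow _ _ hn
    omega
  set E := max 1 (1 / c) * LK * d + L * d
  have hLK := A.LK_pos
  have hL := A.L_nonneg
  have hCw : 0 < max 1 (1 / c) := lt_max_of_lt_left one_pos
  have hD : ∀ᶠ n : ℕ in atTop, D / n ≤ ε :=
    (tendsto_const_div_atTop_nhds_zero_nat D).eventually_le_const hε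
  have hE : ∀ᶠ n : ℕ in atTop, E / n ≤ ε / 2 :=
    (tendsto_const_div_atTop_nhds_zero_nat E).eventually_le_const (half_pos hε)
  filter_upwards [A.ae_eventually_forall_abs_weightedKernelSum_sub_lt hμ hG (half_pos hε)]
    with s hs
  filter_upwards [hs, hfar, hD, hE, A.eventually_le_one_and_rate, eventually_ge_atTop 1]
    with n hn hnfar hnD hnE ⟨hh1, hrate⟩ hn1 x
  have hn0 : (0 : ℝ) < n := by positivity
  have hn1' : (1 : ℝ) ≤ n := by exact_mod_cast hn1
  rcases le_or_gt ((n : ℝ) ^ a) ‖x‖ with hx | hx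
  · obtain ⟨h1, h2⟩ := hnfar s x hx
    have h3 := A.weightedKernelSum_nonneg hn1 s x
    have h4 := mul_nonneg hn0.le (A.target.nonneg x)
    have h5 : n * f x ≤ n * ε := by gcongr; linarith
    have h6 : n * (D / n) ≤ n * ε := by gcongr
    rw [abs_le]
    constructor <;> linarith
  · obtain ⟨g, hg, hxg⟩ := hcover n (by positivity) x (by push_cast; exact hx.le)
    push_cast at hxg
    have h1 := A.abs_weightedKernelSum_sub_le hd hn1 hh1 hrate s x g
    have h2 := hn g hg
    have h3 := A.target_lipschitz g x
    rw [norm_sub_rev] at h3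
    have h4 : max 1 (1 / c) * LK * n ^ 2 * ‖x - g‖ + L * ‖x - g‖ ≤ E / n := by
      calc _ ≤ max 1 (1 / c) * LK * n ^ 2 * (d / n ^ 4) + L * (d / n ^ 4) := by gcongr
        _ = max 1 (1 / c) * LK * d / n ^ 2 + L * d / n ^ 4 := by field_simp
        _ ≤ max 1 (1 / c) * LK * d / n + L * d / n := by
            gcongr <;> exact le_self_pow₀ hn1' (by norm_num)
        _ = E / n := (add_div _ _ _).symm
    have h5 : weightedKernelSum f q₀ K lam h η s n x - n * f x =
        (weightedKernelSum f q₀ K lam h η s n x - weightedKernelSum f q₀ K lam h η s n g) +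
        (weightedKernelSum f q₀ K lam h η s n g - n * f g) + n * (f g - f x) := by ring
    have h6 : |n * (f g - f x)| ≤ n * (L * ‖x - g‖) := by
      rw [abs_mul, abs_of_pos hn0]
      gcongr
    have h7 : n * (max 1 (1 / c) * LK * n ^ 2 * ‖x - g‖ + L * ‖x - g‖) ≤ n * (ε / 2) := by
      gcongr
      linarith
    rw [h5]
    refine (abs_add_three _ _ _).trans ?_
    linarith

/-- Almost surely, the estimate produced by the algorithm converges uniformly to the target. -/
theorem ae_eventually_forall_abs_sraisEstimate_sub_le
    (A : SraisAssumptions f q₀ K lam h η L U B LK U₀ c δ CK rK) (hd : 1 ≤ d)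
    {μ : Measure (ℕ → Rd d)} [IsProbabilityMeasure μ]
    (hμ : IsPathPolicy μ fun k s => proposal f q₀ K lam h η s k) {ε : ℝ} (hε : 0 < ε) :
    ∀ᵐ s ∂μ, ∀ᶠ n : ℕ in atTop, ∀ x, |sraisEstimate f q₀ K lam h η s n x - f x| ≤ ε := by
  have hU := A.U_nonneg
  -- The value `1/2` forces `S ≥ n / 2`. The second value makes the numerator error `n ε' (1 + U)`
  -- at most `n ε / 2`, hence at most `S ε`.
  set ε' := min (1 / 2) (ε / (2 * (1 + U)))
  have hε' : 0 < ε' := lt_min (by norm_num) (by positivity)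
  filter_upwards [A.ae_eventually_forall_abs_weightedKernelSum_sub_le hd hμ hε',
    A.ae_eventually_abs_weightSum_sub_lt hμ hε'] with s hs1 hs2
  filter_upwards [hs1, hs2, eventually_ge_atTop 1] with n hn1 hn2 hn x
  have hn0 : (0 : ℝ) < n := by positivity
  set S := weightSum f q₀ K lam h η s n
  have h1 := hn1 x
  have h2 : n * ε' ≤ n * (1 / 2) := mul_le_mul_of_nonneg_left (min_le_left _ _) hn0.le
  have hS : (n : ℝ) / 2 ≤ S := by
    have := (abs_lt.1 hn2).1
    linarith
  have hS0 : 0 < S := by linarith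
  rw [sraisEstimate_eq_div x hS0.ne', div_sub' hS0.ne', abs_div, abs_of_pos hS0,
    div_le_iff₀ hS0]
  have h3 : weightedKernelSum f q₀ K lam h η s n x - S * f x =
      (weightedKernelSum f q₀ K lam h η s n x - n * f x) + (-(S - n)) * f x := by ring
  have h4 : |(-(S - n)) * f x| ≤ n * ε' * U := by
    rw [abs_mul, abs_neg, abs_of_nonneg (A.target.nonneg x)]
    exact mul_le_mul hn2.le (A.target_le x) (A.target.nonneg x) (by positivity)
  have h5 : ε' * (1 + U) ≤ ε / 2 := by
    calc ε' * (1 + U) ≤ ε / (2 * (1 + U)) * (1 + U) := by gcongr; exact min_le_right _ _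
      _ = ε / 2 := by field_simp
  have h6 := mul_le_mul_of_nonneg_left h5 hn0.le
  have h7 := mul_le_mul_of_nonneg_left hS hε.le
  rw [h3]
  refine (abs_add_le _ _).trans ?_
  linarith

end SraisAssumptions

end Convergence

/-! ### Transfer back to the given probability space. -/

theorem proposition2 {d : ℕ} (hd : 1 ≤ d) {Ω : Type*} [MeasurableSpace Ω] (P : Measure Ω)
    [IsProbabilityMeasure P] (f q₀ K : Rd d → ℝ) (lam h η : ℕ → ℝ) (X : ℕ → Ω → Rd d)
    (hf : IsDensity f) (hq₀ : IsDensity q₀)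
    (hX : IsSRAIS P X f q₀ K lam h η)
    (hseq : SequenceConditions d lam h η)
    (hfreg : TargetRegularity f)
    (hK : KernelRegularity K)
    (hq₀_bdd : ∃ U₀ : ℝ, ∀ x, q₀ x ≤ U₀)
    (hq₀_tail : ∃ c δ : ℝ, 0 < c ∧ 0 < δ ∧ ∀ x, c * (1 + ‖x‖ ^ δ) * f x ≤ q₀ x)
    (hK_tail : ∃ CK rK : ℝ, 0 < CK ∧ 0 < rK ∧ ∀ x, K x ≤ CK * (1 + ‖x‖) ^ (-rK)) :
    ∀ᵐ ω ∂P, Tendsto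
      (fun n : ℕ => ⨆ y : Rd d,
        ENNReal.ofReal |sraisEstimate f q₀ K lam h η (fun i => X i ω) n y - f y|)
      atTop (𝓝 0) := by
  obtain ⟨L, hL⟩ := hfreg.lipschitz
  obtain ⟨U, hU⟩ := hfreg.bounded
  obtain ⟨B, hB⟩ := hK.bounded
  obtain ⟨LK, hLK, hLK'⟩ := hK.lipschitz
  obtain ⟨U₀, hU₀⟩ := hq₀_bdd
  obtain ⟨c, δ, hc, hδ, htail⟩ := hq₀_tail
  obtain ⟨CK, rK, hCK, hrK, hKt⟩ := hK_tail
  -- The Lipschitz constant supplied for `f` carries no sign, hence `max L 0`.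
  have A : SraisAssumptions f q₀ K lam h η (max L 0) U B LK U₀ c δ CK rK :=
    { target := hf, safe := hq₀, seq := hseq, kernel := hK
      target_lipschitz := fun x y => (hL x y).trans
        (mul_le_mul_of_nonneg_right (le_max_left _ _) (norm_nonneg _))
      L_nonneg := le_max_right _ _
      target_le := hU, kernel_le := hB, kernel_lipschitz := hLK', LK_pos := hLK, safe_le := hU₀
      c_pos := hc, δ_pos := hδ, tail := htail, CK_pos := hCK, rK_pos := hrK, kernel_tail := hKt }
  have hpath : ∀ ω i, 1 ≤ i → X i ω = particlePath X ω i := fun ω i hi =>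
    (if_neg (by omega)).symm
  have hX' : HasPolicy P X fun k ω => proposal f q₀ K lam h η (particlePath X ω) k := by
    have h1 : (fun k ω => proposal f q₀ K lam h η (particlePath X ω) k) =
        fun k ω => proposal f q₀ K lam h η (fun i => X i ω) k := by
      funext k ω
      exact (proposal_congr fun i hi _ => hpath ω i hi).symm
    rw [h1]
    exact hX
  have hm := measurable_particlePath hX'.measurable
  have : IsProbabilityMeasure (P.map (particlePath X)) :=
    Measure.isProbabilityMeasure_map hm.aemeasurable
  have hμ : IsPathPolicy (P.map (particlePath X)) fun k s => proposal f q₀ K lam h η s k :=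
    hX'.isPathPolicy A.measurable_proposal A.isDensity_proposal fun k s s' hs => proposal_congr hs
  -- Restricting to the tolerances `1 / (j + 1)` leaves countably many null sets, so one almost sure
  -- event serves every tolerance.
  have hae : ∀ᵐ s ∂P.map (particlePath X), ∀ j : ℕ, ∀ᶠ n : ℕ in atTop, ∀ x,
      |sraisEstimate f q₀ K lam h η s n x - f x| ≤ 1 / (j + 1) :=
    ae_all_iff.2 fun j => A.ae_eventually_forall_abs_sraisEstimate_sub_le hd hμ (by positivity)
  filter_upwards [ae_of_ae_map hm.aemeasurable hae] with ω hω
  rw [ENNReal.tendsto_nhds_zero]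
  intro ε hε
  obtain ⟨r, hr0, hrε⟩ := ENNReal.lt_iff_exists_nnreal_btwn.1 hε
  obtain ⟨j, hj⟩ := exists_nat_one_div_lt (NNReal.coe_pos.2 (ENNReal.coe_pos.1 hr0))
  filter_upwards [hω j] with n hn
  refine iSup_le fun y => le_trans ?_ hrε.le
  rw [sraisEstimate_congr (hpath ω) y, ← ENNReal.ofReal_coe_nnreal]
  exact ENNReal.ofReal_le_ofReal ((hn y).trans hj.le)
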